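/- \textbf{Theorem.} Let $\mathcal X\subset\mathbb R^d$ be compact, let $\rho$ be a Borel probability measure on $\mathcal X$, let $\epsilon>0$, and let $K_0,K_1:\mathcal X\times\mathcal X\to\mathbb R$ be continuous covariance kernels, i.e. continuous, symmetric and positive semidefinite. Write $K_i$ also for the covariance operator on the real Hilbert space $L^2(\mathcal X,\rho)$ given by $[K_i\phi](x)=\int_{\mathcal X}K_i(x,s)\phi(s)\,d\rho(s)$, a positive self-adjoint trace-class operator. For $K,L\in\{K_0,K_1\}$ put \[ M_\epsilon(K,L)=-I+\Big(I+\tfrac{16}{\epsilon^2}K^{1/2}LK^{1/2}\Big)^{1/2}, \] \[ W_{2,\epsilon}^2(K,L)=\mathrm{Tr}[K]+\mathrm{Tr}[L]+\tfrac{\epsilon}{2}\log\det\big(I+\tfrac12M_\epsilon(K,L)\big)-\tfrac{\epsilon}{2}\mathrm{Tr}[M_\epsilon(K,L)], \] \[ S_{2,\epsilon}(K_0,K_1)=W_{2,\epsilon}^2(K_0,K_1)-\tfrac12\big(W_{2,\epsilon}^2(K_0,K_0)+W_{2,\epsilon}^2(K_1,K_1)\big), \] where the square roots are the positive ones, $\mathrm{Tr}[T]=\sum_k\langle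 Te_k,e_k\rangle$ for an orthonormal basis $(e_k)$, and $\det(I+T)=\prod_k(1+\lambda_k)$ is the Fredholm determinant of a self-adjoint trace-class operator $T$ with eigenvalues $\lambda_k$ (counted with multiplicity). Let $x_1,x_2,\dots$ be I.I.D. random points of $\mathcal X$ with law $\rho$. For each $n$ let $\Sigma_K^{(n)}=\big(\tfrac1nK(x_i,x_j)\big)_{i,j=1}^n$ and, for an $n\times n$ matrix $A$ such that $I+A$ has no eigenvalue in $(-\infty,0]$, let \[ F(A)=\mathrm{Tr}\big[-I+(I+A)^{1/2}\big]-\log\det\big(\tfrac12I+\tfrac12(I+A)^{1/2}\big) \] with the principal square root. Define the estimators \[ W_{2,\epsilon}^2(K,L,n)=\mathrm{Tr}\big[\Sigma_K^{(n)}+\Sigma_L^{(n)}\big]-\tfrac{\epsilon}{2}F\Big(\tfrac{16}{\epsilon^2}\Sigma_K^{(n)}\Sigma_L^{(n)}\Big), \] \[ S_{2,\epsilon}(K_0,K_1,n)=W_{2,\epsilon}^2(K_0,K_1,n)-\tfrac12\big(W_{2,\epsilon}^2(K_0,K_0,n)+W_{2,\epsilon}^2(K_1,K_1,n)\big). \]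 Then, almost surely, \[ \lim_{n\to\infty}W_{2,\epsilon}^2(K_0,K_1,n)=W_{2,\epsilon}^2(K_0,K_1)\quad\text{and}\quad \lim_{n\to\infty}S_{2,\epsilon}(K_0,K_1,n)=S_{2,\epsilon}(K_0,K_1). \] -/

import Mathlib

open MeasureTheory ProbabilityTheory Filter Topology

noncomputable section

namespace GPSinkhorn

/-! ### Trace, determinant and square root of operators on a real Hilbert space -/

section Hilbert

variable {H : Type*} [NormedAddCommGroup H] [InnerProductSpace ℝ H] [CompleteSpace H]

/-- The trace `∑ₖ ⟪T eₖ, eₖ⟫` of an operator, computed in an orthonormal (Hilbert) basis. For a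
trace-class operator the sum converges and does not depend on the basis. -/
def opTrace (T : H →L[ℝ] H) : ℝ :=
  ∑' k : (exists_hilbertBasis ℝ H).choose,
    inner ℝ (T ((exists_hilbertBasis ℝ H).choose_spec.choose k))
      ((exists_hilbertBasis ℝ H).choose_spec.choose k)

/-- The Fredholm determinant `det (I + T) = ∏ₖ (1 + λₖ)` of a self-adjoint trace-class operator
`T`, where `λₖ` runs over the eigenvalues of `T`, repeated according to multiplicity. The factor
at `μ = 0` is `1`, and eigenspaces at `μ ≠ 0` are finite-dimensional for such `T`. -/
def fredholmDet (T : H →L[ℝ] H) : ℝ :=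
  ∏' μ : ℝ, (1 + μ) ^ Module.finrank ℝ (Module.End.eigenspace (T : Module.End ℝ H) μ)

open Classical in
/-- The square root of a positive operator `T`: the (unique) positive self-adjoint operator `S`
with `S S = T`. (The value is `0` if there is none.) -/
def opSqrt (T : H →L[ℝ] H) : H →L[ℝ] H :=
  if h : ∃ S : H →L[ℝ] H, S.IsPositive ∧ S ∘L S = T then h.choose else 0

/-- `M_ε(A, B) = -I + (I + (16 / ε²) A^{1/2} B A^{1/2})^{1/2}`. -/
def opM (ε : ℝ) (A B : H →L[ℝ] H) : H →L[ℝ] H :=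
  -ContinuousLinearMap.id ℝ H +
    opSqrt (ContinuousLinearMap.id ℝ H + (16 / ε ^ 2) • (opSqrt A ∘L B ∘L opSqrt A))

/-- The squared entropic 2-Wasserstein distance between positive trace-class operators:
`Tr A + Tr B + (ε/2) log det (I + M_ε(A,B)/2) - (ε/2) Tr M_ε(A,B)`. -/
def opEntropicW2Sq (ε : ℝ) (A B : H →L[ℝ] H) : ℝ :=
  opTrace A + opTrace B
    + ε / 2 * Real.log (fredholmDet ((1 / 2 : ℝ) • opM ε A B))
    - ε / 2 * opTrace (opM ε A B)

end Hilbert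

/-! ### Covariance kernels and covariance operators -/

section Kernel

variable {X : Type*} [TopologicalSpace X]

/-- A continuous function `K` on `X × X` is a covariance kernel (a symmetric positive semidefinite
kernel) if all its Gram matrices `(K(xᵢ, xⱼ))ᵢⱼ` are symmetric and positive semidefinite. -/
def IsCovarianceKernel (K : C(X × X, ℝ)) : Prop :=
  ∀ (n : ℕ) (x : Fin n → X), (Matrix.of fun i j => K (x i, x j)).PosSemidef

variable [CompactSpace X] [MeasurableSpace X] [BorelSpace X]
  (ρ : Measure X) [IsProbabilityMeasure ρ]

/-- The function `x ↦ ∫ K(x, s) φ(s) dρ(s)`. -/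
def kernelIntegral (K : C(X × X, ℝ)) (φ : Lp ℝ 2 ρ) (x : X) : ℝ :=
  ∫ s, K (x, s) * φ s ∂ρ

lemma kernelIntegral_eq_inner (K : C(X × X, ℝ)) (φ : Lp ℝ 2 ρ) (x : X) :
    kernelIntegral ρ K φ x = inner ℝ φ (ContinuousMap.toLp 2 ρ ℝ (K.curry x)) := by
  rw [L2.inner_def, kernelIntegral]
  refine integral_congr_ae ?_
  filter_upwards [ContinuousMap.coeFn_toLp (p := 2) ρ (𝕜 := ℝ) (K.curry x)] with s hs
  rw [hs]
  simp

lemma continuous_kernelIntegral (K : C(X × X, ℝ)) (φ : Lp ℝ 2 ρ) :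
    Continuous (kernelIntegral ρ K φ) := by
  have h : kernelIntegral ρ K φ =
      fun x => inner ℝ φ (ContinuousMap.toLp 2 ρ ℝ (K.curry x)) :=
    funext (kernelIntegral_eq_inner ρ K φ)
  rw [h]
  fun_prop

lemma norm_kernelIntegral_le (K : C(X × X, ℝ)) (φ : Lp ℝ 2 ρ) (x : X) :
    ‖kernelIntegral ρ K φ x‖ ≤ ‖K‖ * ‖φ‖ := by
  rw [kernelIntegral_eq_inner]
  have h1 : ‖ContinuousMap.toLp 2 ρ ℝ (K.curry x)‖ ≤ ‖K‖ := by
    refine (Lp.norm_le_of_ae_bound (norm_nonneg K) ?_).trans ?_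
    · filter_upwards [ContinuousMap.coeFn_toLp (p := 2) ρ (𝕜 := ℝ) (K.curry x)] with s hs
      rw [hs]
      exact K.norm_coe_le_norm (x, s)
    · simp [measureUnivNNReal]
  calc _ ≤ ‖φ‖ * ‖ContinuousMap.toLp 2 ρ ℝ (K.curry x)‖ := norm_inner_le_norm _ _
    _ ≤ ‖φ‖ * ‖K‖ := by gcongr
    _ = _ := mul_comm _ _

lemma memLp_kernelIntegral (K : C(X × X, ℝ)) (φ : Lp ℝ 2 ρ) :
    MemLp (kernelIntegral ρ K φ) 2 ρ :=
  ContinuousMap.memLp ρ ℝ (⟨_, continuous_kernelIntegral ρ K φ⟩ : C(X, ℝ))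

/-- The covariance operator `[K φ](x) = ∫ K(x, s) φ(s) dρ(s)` on `L²(X, ρ)`. -/
def covarianceOperator (K : C(X × X, ℝ)) : Lp ℝ 2 ρ →L[ℝ] Lp ℝ 2 ρ :=
  LinearMap.mkContinuous
    { toFun := fun φ => (memLp_kernelIntegral ρ K φ).toLp (kernelIntegral ρ K φ)
      map_add' := fun φ ψ => by
        rw [← MemLp.toLp_add]
        congr 1
        funext x
        simp [kernelIntegral_eq_inner, inner_add_left]
      map_smul' := fun c φ => by
        rw [RingHom.id_apply, ← MemLp.toLp_const_smul]
        congr 1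
        funext x
        simp [kernelIntegral_eq_inner, inner_smul_left] }
    ‖K‖ (fun φ => by
      refine (Lp.norm_le_of_ae_bound (C := ‖K‖ * ‖φ‖) (by positivity) ?_).trans ?_
      · filter_upwards [(memLp_kernelIntegral ρ K φ).coeFn_toLp] with x hx
        exact (congrArg norm hx).le.trans (norm_kernelIntegral_le ρ K φ x)
      · simp [measureUnivNNReal])

lemma covarianceOperator_apply_ae (K : C(X × X, ℝ)) (φ : Lp ℝ 2 ρ) :
    covarianceOperator ρ K φ =ᵐ[ρ] fun x => ∫ s, K (x, s) * φ s ∂ρ :=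
  (memLp_kernelIntegral ρ K φ).coeFn_toLp

/-- The squared entropic 2-Wasserstein distance `W²_{2,ε}(K₀, K₁)` between (the covariance
operators of) two covariance kernels. -/
def entropicW2Sq (ε : ℝ) (K₀ K₁ : C(X × X, ℝ)) : ℝ :=
  opEntropicW2Sq ε (covarianceOperator ρ K₀) (covarianceOperator ρ K₁)

/-- The 2-Sinkhorn divergence `S_{2,ε}(K₀, K₁)`. -/
def sinkhornDiv (ε : ℝ) (K₀ K₁ : C(X × X, ℝ)) : ℝ :=
  entropicW2Sq ρ ε K₀ K₁ - 1 / 2 * (entropicW2Sq ρ ε K₀ K₀ + entropicW2Sq ρ ε K₁ K₁)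

end Kernel

/-! ### The empirical estimators -/

section Empirical

variable {n : ℕ}

open Classical in
/-- The principal square root of a real square matrix `A`: the (unique) matrix `B` with `B B = A`
all of whose complex eigenvalues have positive real part. It exists whenever `A` has no eigenvalue
in `(-∞, 0]`. (The value is `0` if there is none.) -/
def principalSqrt (A : Matrix (Fin n) (Fin n) ℝ) : Matrix (Fin n) (Fin n) ℝ :=
  if h : ∃ B : Matrix (Fin n) (Fin n) ℝ,
      B * B = A ∧ ∀ z ∈ spectrum ℂ (B.map (algebraMap ℝ ℂ)), 0 < z.re
  then h.choose else 0

/-- `F(A) = Tr[-I + (I + A)^{1/2}] - log det (I/2 + (I + A)^{1/2}/2)`. -/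
def matF (A : Matrix (Fin n) (Fin n) ℝ) : ℝ :=
  (-1 + principalSqrt (1 + A)).trace
    - Real.log ((1 / 2 : ℝ) • (1 : Matrix (Fin n) (Fin n) ℝ)
        + (1 / 2 : ℝ) • principalSqrt (1 + A)).det

variable {X : Type*} [TopologicalSpace X]

/-- The normalized Gram matrix `Σ_K^{(n)} = (K(xᵢ, xⱼ) / n)ᵢⱼ` of sample points `x₁, …, xₙ`. -/
def gramMatrix (K : C(X × X, ℝ)) (x : Fin n → X) : Matrix (Fin n) (Fin n) ℝ :=
  Matrix.of fun i j => 1 / (n : ℝ) * K (x i, x j)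

/-- The estimator
`W²_{2,ε}(K₀, K₁, n) = Tr[Σ_{K₀} + Σ_{K₁}] - (ε/2) F((16/ε²) Σ_{K₀} Σ_{K₁})`. -/
def empEntropicW2Sq (ε : ℝ) (K₀ K₁ : C(X × X, ℝ)) (x : Fin n → X) : ℝ :=
  (gramMatrix K₀ x + gramMatrix K₁ x).trace
    - ε / 2 * matF ((16 / ε ^ 2) • (gramMatrix K₀ x * gramMatrix K₁ x))

/-- The empirical Sinkhorn divergence `S_{2,ε}(K₀, K₁, n)`. -/
def empSinkhornDiv (ε : ℝ) (K₀ K₁ : C(X × X, ℝ)) (x : Fin n → X) : ℝ :=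
  empEntropicW2Sq ε K₀ K₁ x - 1 / 2 * (empEntropicW2Sq ε K₀ K₀ x + empEntropicW2Sq ε K₁ K₁ x)

end Empirical

end GPSinkhorn

end

/-! ### The function `F` on products of positive semidefinite matrices -/

namespace GPSinkhorn

open Matrix Polynomial

/-! Write f for `scalarF` and c = 16/ε². Both the distance and its estimator are traces of the
kernels minus ε/2 times a sum of values of f. For the operators the sum is Σ f(cλᵢ), with λᵢ the
eigenvalues of K₀^{1/2} K₁ K₀^{1/2} (`opEntropicW2Sq_eq_of_diagonal`). The product of the two Gram
matrices is not symmetric, but it factors as PQ with QP diagonal and nonnegative, so there the sum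
is Σ f(cμᵢ) with μ the diagonal of QP (`exists_matF_eq_sum`).

Eigenvalues and operators on different spaces need not be compared: the power sums suffice. Those of
λ and of μ are the traces of (K₀K₁)ᵏ⁺¹, up to cyclic order, and of the matching matrix power. Both
equal `kernelMoment L K₀ K₁ k`, with L integration against ρ in one case and the sample average in
the other. The strong law on a countable dense subset of C(X) gives, off one null set, convergence
of the averages on every continuous function. The averages are contractions, so this convergence is
uniform on continuous compact families, and it passes through iterated kernel compositions
(`tendsto_kernelMoment`).

Since f(0) = 0 and f is differentiable at 0, f(ct) = t g(t) with g continuous. Approximating g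
uniformly by a polynomial p leaves an error of at most η Σ μᵢ, which the first moment controls,
while Σ μᵢ p(μᵢ) is a combination of power sums (`tendsto_sum_of_tendsto_moments`).

The traces of K₀ and K₁ themselves are ∫ K(x,x) dρ; a feature map into a Hilbert space replaces
Mercer's theorem there (`hasSum_inner_covarianceOperator`). -/

/-- The scalar function `t ↦ √(1 + t) - 1 - log (1/2 + √(1 + t)/2)`. -/
noncomputable def scalarF (t : ℝ) : ℝ :=
  √(1 + t) - 1 - Real.log (1 / 2 + 1 / 2 * √(1 + t))

section MatrixPart

variable {n : ℕ}

/-- An intertwining matrix `Y X = X Z` vanishes if `Y` and `Z` have disjoint spectra. -/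
lemma eq_zero_of_intertwining {Y X Z : Matrix (Fin n) (Fin n) ℂ} (h : Y * X = X * Z)
    (hdisj : Disjoint (spectrum ℂ Y) (spectrum ℂ Z)) : X = 0 := by
  rcases Nat.eq_zero_or_pos n with rfl | hn
  · exact Subsingleton.elim _ _
  have hp : ∀ p : ℂ[X], aeval Y p * X = X * aeval Z p := by
    intro p
    induction p using Polynomial.induction_on' with
    | add p q hp hq => simp [add_mul, mul_add, hp, hq]
    | monomial k a =>
      have hk : ∀ k : ℕ, Y ^ k * X = X * Z ^ k := by
        intro k
        induction k with
        | zero => simp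
        | succ k ih => rw [pow_succ, mul_assoc, h, ← mul_assoc, ih, mul_assoc, ← pow_succ]
      simp [aeval_monomial, Algebra.algebraMap_eq_smul_one, hk]
  -- By spectral mapping the eigenvalues of χ_Z(Y) are the χ_Z(z) with z in the spectrum of Y, none
  -- of them zero; Cayley–Hamilton kills χ_Z(Z) on the other side. Spectral mapping needs positive
  -- degree, hence the separate case n = 0.
  have hu : IsUnit (aeval Y Z.charpoly) := by
    by_contra hu
    have h0 : (0 : ℂ) ∈ spectrum ℂ (aeval Y Z.charpoly) := (spectrum.zero_mem_iff ℂ).2 hu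
    rw [spectrum.map_polynomial_aeval_of_degree_pos] at h0
    · obtain ⟨z, hz, hz0⟩ := h0
      exact Set.disjoint_left.1 hdisj hz (Matrix.mem_spectrum_iff_isRoot_charpoly.2 hz0)
    · rw [Matrix.charpoly_degree_eq_dim]
      simpa using hn
  have h1 := hp Z.charpoly
  rw [Matrix.aeval_self_charpoly, mul_zero] at h1
  exact (hu.mul_right_eq_zero).1 h1

/-- Two roots Y and B satisfy Y(Y - B) = (Y - B)(-B), and the spectra of Y and -B lie in opposite
open half-planes, so Y = B. An explicit root thus identifies the chosen one. -/
lemma principalSqrt_eq {A B : Matrix (Fin n) (Fin n) ℝ} (hB : B * B = A)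
    (hs : ∀ z ∈ spectrum ℂ (B.map (algebraMap ℝ ℂ)), 0 < z.re) : principalSqrt A = B := by
  have hex : ∃ B : Matrix (Fin n) (Fin n) ℝ,
      B * B = A ∧ ∀ z ∈ spectrum ℂ (B.map (algebraMap ℝ ℂ)), 0 < z.re := ⟨B, hB, hs⟩
  rw [principalSqrt, dif_pos hex]
  obtain ⟨hY, hYs⟩ := hex.choose_spec
  set Y := hex.choose
  have hmap : Function.Injective fun M : Matrix (Fin n) (Fin n) ℝ => M.map (algebraMap ℝ ℂ) :=
    Matrix.map_injective (algebraMap ℝ ℂ).injective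
  have h0 : Y.map (algebraMap ℝ ℂ) - B.map (algebraMap ℝ ℂ) = 0 := by
    refine eq_zero_of_intertwining (Y := Y.map (algebraMap ℝ ℂ)) (Z := -B.map (algebraMap ℝ ℂ))
      ?_ ?_
    · have h1 : Y.map (algebraMap ℝ ℂ) * Y.map (algebraMap ℝ ℂ)
          = B.map (algebraMap ℝ ℂ) * B.map (algebraMap ℝ ℂ) := by
        rw [← Matrix.map_mul, ← Matrix.map_mul, hY, hB]
      rw [mul_sub, h1]
      noncomm_ring
    · rw [Set.disjoint_left]
      intro z hz hz'
      have h1 := hYs z hz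
      have h2 : -z ∈ spectrum ℂ (B.map (algebraMap ℝ ℂ)) := by
        rw [← neg_neg (B.map (algebraMap ℝ ℂ)), ← spectrum.neg_eq]
        simpa using hz'
      have h3 := hs _ h2
      rw [Complex.neg_re] at h3
      linarith
  exact hmap (sub_eq_zero.1 h0)

/-- The product of two positive semidefinite matrices factors as `P Q` with `Q P` diagonal and
nonnegative. -/
lemma exists_factor_diagonal {A B : Matrix (Fin n) (Fin n) ℝ} (hA : A.PosSemidef)
    (hB : B.PosSemidef) : ∃ (P Q : Matrix (Fin n) (Fin n) ℝ) (μ : Fin n → ℝ),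
      (∀ i, 0 ≤ μ i) ∧ A * B = P * Q ∧ Q * P = diagonal μ := by
  obtain ⟨C, hC⟩ : ∃ C : Matrix (Fin n) (Fin n) ℝ, A = star C * C := by
    open scoped MatrixOrder in exact CStarAlgebra.nonneg_iff_eq_star_mul_self.mp hA.nonneg
  -- With A = CᴴC, swapping the factors of AB = Cᴴ(CB) gives the symmetric CBCᴴ; its eigenvector
  -- matrix is absorbed into P and Q.
  have hN : (C * B * Cᴴ).PosSemidef := hB.mul_mul_conjTranspose_same C
  have hsp := hN.1.spectral_theorem
  set U := hN.1.eigenvectorUnitary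
  have hU : star (U : Matrix (Fin n) (Fin n) ℝ) * U = 1 := Unitary.coe_star_mul_self U
  have hU' : (U : Matrix (Fin n) (Fin n) ℝ) * star (U : Matrix (Fin n) (Fin n) ℝ) = 1 :=
    Unitary.coe_mul_star_self U
  rw [Unitary.conjStarAlgAut_apply] at hsp
  refine ⟨Cᴴ * U, star (U : Matrix (Fin n) (Fin n) ℝ) * (C * B), hN.1.eigenvalues,
    hN.eigenvalues_nonneg, ?_, ?_⟩
  · rw [hC, mul_assoc, mul_assoc Cᴴ, ← mul_assoc _ (star _), hU', one_mul]
    rfl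
  · calc star (U : Matrix (Fin n) (Fin n) ℝ) * (C * B) * (Cᴴ * U)
        = star (U : Matrix (Fin n) (Fin n) ℝ) * (C * B * Cᴴ) * U := by simp only [mul_assoc]
      _ = star (U : Matrix (Fin n) (Fin n) ℝ)
            * (U * diagonal hN.1.eigenvalues * star (U : Matrix (Fin n) (Fin n) ℝ)) * U :=
          congrArg (fun M => star (U : Matrix (Fin n) (Fin n) ℝ) * M * U) hsp
      _ = (star (U : Matrix (Fin n) (Fin n) ℝ) * U) * diagonal hN.1.eigenvalues
            * (star (U : Matrix (Fin n) (Fin n) ℝ) * U) := by simp only [mul_assoc]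
      _ = _ := by rw [hU]; simp

/-- Nonzero spectrum, trace and `det (1 + ·)` are unchanged when two factors are swapped, so `P * Q`
can be treated like the diagonal `Q * P`. -/
lemma matF_smul_mul_eq_sum {P Q : Matrix (Fin n) (Fin n) ℝ} {μ : Fin n → ℝ} (hμ : ∀ i, 0 ≤ μ i)
    (h : Q * P = diagonal μ) {c : ℝ} (hc : 0 ≤ c) :
    matF (c • (P * Q)) = ∑ i, scalarF (c * μ i) := by
  set s : Fin n → ℝ := fun i => √(1 + c * μ i) with hs
  have hs0 : ∀ i, 0 ≤ s i := fun i => Real.sqrt_nonneg _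
  have hs1 : ∀ i, s i * s i = 1 + c * μ i := fun i =>
    Real.mul_self_sqrt (by have := mul_nonneg hc (hμ i); linarith)
  have hs2 : ∀ i, 1 ≤ s i := fun i => by
    have := mul_nonneg hc (hμ i); nlinarith [hs0 i, hs1 i]
  -- The root is sought as 1 + P diag(γ) Q. Squaring requires 2γ + γ²μ = c; as s² = 1 + cμ, this is
  -- γ = (s - 1)/μ, written in a form valid also at μ = 0.
  set γ : Fin n → ℝ := fun i => c / (1 + s i) with hγ
  have hγμ : ∀ i, γ i * μ i = s i - 1 := fun i => by
    have : 1 + s i ≠ 0 := by linarith [hs0 i]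
    simp only [hγ]
    field_simp
    linear_combination -(hs1 i)
  have hγ2 : ∀ i, γ i + γ i + γ i * μ i * γ i = c := fun i => by
    have : 1 + s i ≠ 0 := by linarith [hs0 i]
    rw [hγμ]
    simp only [hγ]
    field_simp
    ring
  have hdiag : diagonal γ * Q * P = diagonal fun i => s i - 1 := by
    rw [mul_assoc, h, diagonal_mul_diagonal]
    simp only [hγμ]
  have hsqrt : principalSqrt (1 + c • (P * Q)) = 1 + P * (diagonal γ * Q) := by
    refine principalSqrt_eq ?_ ?_
    · have hd : diagonal γ + diagonal γ + diagonal γ * (Q * P) * diagonal γ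
          = c • (1 : Matrix (Fin n) (Fin n) ℝ) := by
        rw [h, diagonal_mul_diagonal, diagonal_mul_diagonal, diagonal_add, diagonal_add,
          smul_one_eq_diagonal]
        simp only [hγ2]
      calc (1 + P * (diagonal γ * Q)) * (1 + P * (diagonal γ * Q))
          = 1 + P * (diagonal γ + diagonal γ + diagonal γ * (Q * P) * diagonal γ) * Q := by
            noncomm_ring
        _ = _ := by rw [hd]; simp
    -- A nonzero eigenvalue of P diag(γ) Q is one of diag(γ) Q P = diag(s - 1), so every eigenvalue
    -- of the root is 1 or some sᵢ ≥ 1.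
    · intro z hz
      by_contra hre
      rw [Matrix.map_add _ (map_add _), Matrix.map_one _ (map_zero _) (map_one _), Matrix.map_mul,
        ← map_one (algebraMap ℂ (Matrix (Fin n) (Fin n) ℂ)), ← spectrum.singleton_add_eq] at hz
      obtain ⟨_, rfl, w, hw, rfl⟩ := hz
      have hw0 : w ≠ 0 := by rintro rfl; simp at hre
      have hmem : w ∈ spectrum ℂ (P.map (algebraMap ℝ ℂ) * (diagonal γ * Q).map (algebraMap ℝ ℂ))
          \ {0} := ⟨hw, hw0⟩
      rw [spectrum.nonzero_mul_comm, ← Matrix.map_mul, hdiag,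
        Matrix.diagonal_map (map_zero _), spectrum_diagonal] at hmem
      obtain ⟨⟨i, rfl⟩, -⟩ := hmem
      simp only [Complex.coe_algebraMap, Complex.add_re, Complex.one_re,
        Complex.ofReal_re] at hre
      linarith [hs2 i]
  have htr : (P * (diagonal γ * Q)).trace = ∑ i, (s i - 1) := by
    rw [trace_mul_comm, hdiag, trace_diagonal]
  have hdet : ((1 / 2 : ℝ) • (1 : Matrix (Fin n) (Fin n) ℝ)
      + (1 / 2 : ℝ) • (1 + P * (diagonal γ * Q))).det = ∏ i, (1 / 2 + 1 / 2 * s i) := by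
    have h1 : (1 / 2 : ℝ) • (1 : Matrix (Fin n) (Fin n) ℝ)
      + (1 / 2 : ℝ) • (1 + P * (diagonal γ * Q)) = 1 + P * ((1 / 2 : ℝ) • (diagonal γ * Q)) := by
      rw [smul_add, ← add_assoc, ← add_smul, mul_smul_comm]
      norm_num
    rw [h1, det_one_add_mul_comm, smul_mul_assoc, hdiag, ← diagonal_smul, ← diagonal_one,
      diagonal_add, det_diagonal]
    refine Finset.prod_congr rfl fun i _ => ?_
    simp only [Pi.smul_apply, smul_eq_mul]
    ring
  rw [matF, hsqrt, neg_add_cancel_left, htr, hdet, Real.log_prod, ← Finset.sum_sub_distrib]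
  · rfl
  · intro i _
    have := hs0 i
    positivity

lemma trace_mul_pow_eq_sum {P Q : Matrix (Fin n) (Fin n) ℝ} {μ : Fin n → ℝ}
    (h : Q * P = diagonal μ) (k : ℕ) :
    ((P * Q) ^ (k + 1)).trace = ∑ i, μ i ^ (k + 1) := by
  have h1 : ∀ k : ℕ, (P * Q) ^ (k + 1) = P * ((Q * P) ^ k * Q) := by
    intro k
    induction k with
    | zero => simp
    | succ k ih => rw [pow_succ', ih, pow_succ']; simp only [mul_assoc]
  rw [h1, trace_mul_comm, mul_assoc, ← pow_succ, h, diagonal_pow, trace_diagonal]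
  rfl

/-- The value of `F` at the product of two positive semidefinite matrices, in terms of numbers
whose power sums are the traces of the powers of the product. -/
lemma exists_matF_eq_sum {A B : Matrix (Fin n) (Fin n) ℝ} (hA : A.PosSemidef)
    (hB : B.PosSemidef) : ∃ μ : Fin n → ℝ, (∀ i, 0 ≤ μ i) ∧
      (∀ c, 0 ≤ c → matF (c • (A * B)) = ∑ i, scalarF (c * μ i)) ∧
      ∀ k : ℕ, ∑ i, μ i ^ (k + 1) = ((A * B) ^ (k + 1)).trace := by
  obtain ⟨P, Q, μ, hμ, hPQ, hQP⟩ := exists_factor_diagonal hA hB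
  refine ⟨μ, hμ, fun c hc => ?_, fun k => ?_⟩
  · rw [hPQ, matF_smul_mul_eq_sum hμ hQP hc]
  · rw [hPQ, trace_mul_pow_eq_sum hQP]

end MatrixPart

end GPSinkhorn

/-! ### Operators that are diagonal in a Hilbert basis -/

namespace GPSinkhorn

open scoped ENNReal InnerProductSpace

section InnerProduct

variable {H : Type*} [NormedAddCommGroup H] [InnerProductSpace ℝ H] {ι κ : Type*}

lemma hasSum_sq_inner (b : HilbertBasis ι ℝ H) (x : H) :
    HasSum (fun i => ⟪b i, x⟫_ℝ ^ 2) (‖x‖ ^ 2) := by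
  have h := b.hasSum_inner_mul_inner x x
  rw [real_inner_self_eq_norm_sq] at h
  refine h.congr_fun fun i => ?_
  rw [real_inner_comm, sq]

/-- The quadratic form of an operator that is diagonal in a Hilbert basis. -/
lemma hasSum_inner_of_diagonal (b : HilbertBasis ι ℝ H) {T : H →L[ℝ] H} {f : ι → ℝ}
    (hT : ∀ i, T (b i) = f i • b i) (x y : H) :
    HasSum (fun i => f i * ⟪b i, x⟫_ℝ * ⟪b i, y⟫_ℝ) ⟪T x, y⟫_ℝ := by
  have h := ((b.hasSum_repr x).mapL T).mapL (innerSL ℝ y)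
  simp only [innerSL_apply_apply] at h
  rw [real_inner_comm y (T x)]
  refine h.congr_fun fun i => ?_
  rw [map_smul, hT, inner_smul_right, inner_smul_right, b.repr_apply_apply, real_inner_comm y]
  ring

lemma isPositive_of_diagonal (b : HilbertBasis ι ℝ H) {T : H →L[ℝ] H} {f : ι → ℝ}
    (hT : ∀ i, T (b i) = f i • b i) (hf : ∀ i, 0 ≤ f i) : T.IsPositive := by
  refine ⟨fun x y => ?_, fun x => ?_⟩
  · refine (hasSum_inner_of_diagonal b hT x y).unique ?_
    rw [real_inner_comm]
    refine (hasSum_inner_of_diagonal b hT y x).congr_fun fun i => ?_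
    ring
  · have h : 0 ≤ ⟪T x, x⟫_ℝ := (hasSum_inner_of_diagonal b hT x x).nonneg fun i => by
      rw [mul_assoc]
      exact mul_nonneg (hf i) (mul_self_nonneg _)
    simpa [ContinuousLinearMap.reApplyInnerSelf_apply] using h

lemma ext_hilbertBasis (b : HilbertBasis ι ℝ H) {S T : H →L[ℝ] H} (h : ∀ i, S (b i) = T (b i)) :
    S = T := by
  refine ContinuousLinearMap.ext_on (s := Set.range b) ?_ ?_
  · exact Submodule.dense_iff_topologicalClosure_eq_top.2 b.dense_span
  · rintro _ ⟨i, rfl⟩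
    exact h i

lemma exists_diagonal_operator (b : HilbertBasis ι ℝ H) (f : ι → ℝ) {C : ℝ}
    (hf : ∀ i, |f i| ≤ C) : ∃ T : H →L[ℝ] H, ∀ i, T (b i) = f i • b i := by
  classical
  let D : lp (fun _ : ι => ℝ) 2 →L[ℝ] lp (fun _ : ι => ℝ) 2 :=
    lp.mapCLM 2 (fun i => f i • ContinuousLinearMap.id ℝ ℝ) (abs_nonneg C) fun i => by
      refine ContinuousLinearMap.opNorm_le_bound _ (abs_nonneg C) fun x => ?_
      simp only [smul_apply, ContinuousLinearMap.id_apply, norm_smul,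
        Real.norm_eq_abs]
      exact mul_le_mul_of_nonneg_right ((hf i).trans (le_abs_self C)) (norm_nonneg x)
  refine ⟨b.repr.symm.toContinuousLinearEquiv.toContinuousLinearMap ∘L D ∘L
    b.repr.toContinuousLinearEquiv.toContinuousLinearMap, fun i => ?_⟩
  apply b.repr.injective
  have h1 : D (lp.single 2 i 1) = f i • lp.single 2 i (1 : ℝ) := by
    ext j
    by_cases hij : j = i
    · subst hij; simp [D]
    · simp [D, hij]
  simp [b.repr_self, h1]

/-- B + σ is injective for positive B and σ > 0, and it annihilates (B - σ)v. This is uniqueness of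
the positive root, one eigenvector at a time. -/
lemma apply_eq_of_isPositive_of_sq {B : H →L[ℝ] H} (hB : B.IsPositive) {σ : ℝ} (hσ : 0 < σ) {v : H}
    (h : B (B v) = (σ ^ 2) • v) : B v = σ • v := by
  set w := B v - σ • v with hw
  have h1 : B w = -(σ • w) := by
    rw [hw, map_sub, map_smul, h, smul_sub, smul_smul, sq]
    abel
  have h2 : 0 ≤ ⟪B w, w⟫_ℝ := hB.inner_nonneg_left w
  rw [h1, inner_neg_left, inner_smul_left, real_inner_self_eq_norm_sq] at h2
  have h3 : ‖w‖ ^ 2 ≤ 0 := by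
    simp only [conj_trivial] at h2
    nlinarith [sq_nonneg ‖w‖]
  have h4 : w = 0 := norm_eq_zero.1 (pow_eq_zero_iff two_ne_zero |>.1 (le_antisymm h3 (sq_nonneg _)))
  exact sub_eq_zero.1 h4

/-- Moves nonnegative sums to `ℝ≥0∞`, where double sums commute unconditionally. -/
lemma hasSum_iff_tsum_ofReal {u : ι → ℝ} (hu : ∀ i, 0 ≤ u i) {a : ℝ} (ha : 0 ≤ a) :
    HasSum u a ↔ ∑' i, ENNReal.ofReal (u i) = ENNReal.ofReal a := by
  constructor
  · intro h
    rw [← h.tsum_eq, ENNReal.ofReal_tsum_of_nonneg hu h.summable]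
  · intro h
    have hs : Summable u := by
      have := ENNReal.summable_toReal (h.trans_ne ENNReal.ofReal_ne_top)
      simpa [ENNReal.toReal_ofReal (hu _)] using this
    rw [← ENNReal.ofReal_tsum_of_nonneg hu hs,
      ENNReal.ofReal_eq_ofReal_iff (tsum_nonneg hu) ha] at h
    exact h ▸ hs.hasSum

/-- Expand ⟪T eₖ, eₖ⟫ = Σᵢ fᵢ ⟪eₖ, bᵢ⟫², exchange the sums, and use Parseval for the unit vector bᵢ.
-/
lemma tsum_ofReal_inner_of_diagonal (b : HilbertBasis ι ℝ H) (e : HilbertBasis κ ℝ H)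
    {T : H →L[ℝ] H} {f : ι → ℝ} (hT : ∀ i, T (b i) = f i • b i) (hf : ∀ i, 0 ≤ f i) :
    ∑' k, ENNReal.ofReal ⟪T (e k), e k⟫_ℝ = ∑' i, ENNReal.ofReal (f i) := by
  have h1 : ∀ k, ENNReal.ofReal ⟪T (e k), e k⟫_ℝ
      = ∑' i, ENNReal.ofReal (f i) * ENNReal.ofReal (⟪e k, b i⟫_ℝ ^ 2) := by
    intro k
    have h := hasSum_inner_of_diagonal b hT (e k) (e k)
    rw [← h.tsum_eq, ENNReal.ofReal_tsum_of_nonneg _ h.summable]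
    · refine tsum_congr fun i => ?_
      rw [← ENNReal.ofReal_mul (hf i), real_inner_comm, sq, mul_assoc]
    · intro i
      rw [mul_assoc]
      exact mul_nonneg (hf i) (mul_self_nonneg _)
  simp_rw [h1]
  rw [ENNReal.tsum_comm]
  refine tsum_congr fun i => ?_
  rw [ENNReal.tsum_mul_left]
  have h2 := (hasSum_iff_tsum_ofReal (fun k => sq_nonneg _) (sq_nonneg _)).1 (hasSum_sq_inner e (b i))
  rw [h2, b.orthonormal.1 i]
  simp

/-- The trace of a positive operator that is diagonal in some Hilbert basis can be computed in any
Hilbert basis. -/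
lemma hasSum_inner_iff_of_diagonal (b : HilbertBasis ι ℝ H) (e : HilbertBasis κ ℝ H)
    {T : H →L[ℝ] H} {f : ι → ℝ} (hT : ∀ i, T (b i) = f i • b i) (hf : ∀ i, 0 ≤ f i) {a : ℝ} :
    HasSum (fun k => ⟪T (e k), e k⟫_ℝ) a ↔ HasSum f a := by
  have hpos : ∀ k, 0 ≤ ⟪T (e k), e k⟫_ℝ := fun k =>
    (isPositive_of_diagonal b hT hf).inner_nonneg_left (e k)
  constructor <;> intro h
  · have ha := h.nonneg hpos
    rwa [hasSum_iff_tsum_ofReal hpos ha, tsum_ofReal_inner_of_diagonal b e hT hf,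
      ← hasSum_iff_tsum_ofReal hf ha] at h
  · have ha := h.nonneg hf
    rwa [hasSum_iff_tsum_ofReal hpos ha, tsum_ofReal_inner_of_diagonal b e hT hf,
      ← hasSum_iff_tsum_ofReal hf ha]

/-- The diagonal operator with entries √fᵢ is a root, so `opSqrt` does not take its default value.
-/
lemma opSqrt_spec_of_diagonal (b : HilbertBasis ι ℝ H) {T : H →L[ℝ] H} {f : ι → ℝ}
    (hT : ∀ i, T (b i) = f i • b i) (hf : ∀ i, 0 ≤ f i) :
    (opSqrt T).IsPositive ∧ opSqrt T ∘L opSqrt T = T := by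
  have hex : ∃ S : H →L[ℝ] H, S.IsPositive ∧ S ∘L S = T := by
    have hbd : ∀ i, |√(f i)| ≤ √‖T‖ := by
      intro i
      rw [abs_of_nonneg (Real.sqrt_nonneg _)]
      refine Real.sqrt_le_sqrt ?_
      have h := T.le_opNorm (b i)
      rwa [hT, norm_smul, b.orthonormal.1 i, mul_one, mul_one, Real.norm_eq_abs,
        abs_of_nonneg (hf i)] at h
    obtain ⟨S, hS⟩ := exists_diagonal_operator b (fun i => √(f i)) hbd
    refine ⟨S, isPositive_of_diagonal b hS fun i => Real.sqrt_nonneg _, ext_hilbertBasis b ?_⟩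
    intro i
    rw [ContinuousLinearMap.comp_apply, hS, map_smul, hS, smul_smul, Real.mul_self_sqrt (hf i), hT]
  rw [opSqrt, dif_pos hex]
  exact hex.choose_spec

lemma opSqrt_apply_of_diagonal (b : HilbertBasis ι ℝ H) {T : H →L[ℝ] H} {f : ι → ℝ}
    (hT : ∀ i, T (b i) = f i • b i) (hf : ∀ i, 0 < f i) (i : ι) :
    opSqrt T (b i) = √(f i) • b i := by
  obtain ⟨h1, h2⟩ := opSqrt_spec_of_diagonal b hT fun i => (hf i).le
  refine apply_eq_of_isPositive_of_sq h1 (Real.sqrt_pos.2 (hf i)) ?_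
  rw [← ContinuousLinearMap.comp_apply, h2, hT, Real.sq_sqrt (hf i).le]

/-- Multiplicities of nonzero eigenvalues of an operator that is diagonal in a Hilbert basis. -/
lemma finrank_eigenspace_of_diagonal (b : HilbertBasis ι ℝ H) {T : H →L[ℝ] H} {f : ι → ℝ}
    (hT : ∀ i, T (b i) = f i • b i) (hf : ∀ i, 0 ≤ f i) (μ : ℝ) [Fintype {i // f i = μ}] :
    Module.finrank ℝ (Module.End.eigenspace (T : Module.End ℝ H) μ)
      = Fintype.card {i // f i = μ} := by
  have hspan : Module.End.eigenspace (T : Module.End ℝ H) μ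
      = Submodule.span ℝ (Set.range fun i : {i // f i = μ} => b i) := by
    apply le_antisymm
    · intro v hv
      rw [Module.End.mem_eigenspace_iff] at hv
      have hv' : T v = μ • v := hv
      have h0 : ∀ i, f i ≠ μ → ⟪b i, v⟫_ℝ = 0 := by
        intro i hi
        have h1 : ⟪T (b i), v⟫_ℝ = ⟪b i, T v⟫_ℝ := (isPositive_of_diagonal b hT hf).1 (b i) v
        rw [hT, hv', inner_smul_left, inner_smul_right, conj_trivial] at h1
        have h2 : (f i - μ) * ⟪b i, v⟫_ℝ = 0 := by linear_combination h1
        exact (mul_eq_zero.1 h2).resolve_left (sub_ne_zero.2 hi)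
      have h3 : HasSum (fun i : {i // f i = μ} => b.repr v i • b i) v := by
        refine (hasSum_subtype_iff_of_support_subset (s := {i | f i = μ})
          (f := fun i => b.repr v i • b i) ?_).2 (b.hasSum_repr v)
        intro i hi
        by_contra hne
        refine hi ?_
        simp only [b.repr_apply_apply, h0 i hne, zero_smul]
      rw [h3.unique (hasSum_fintype _)]
      exact Submodule.sum_mem _ fun i _ => Submodule.smul_mem _ _ (Submodule.subset_span ⟨i, rfl⟩)
    · rw [Submodule.span_le]
      rintro _ ⟨⟨i, rfl⟩, rfl⟩
      rw [SetLike.mem_coe, Module.End.mem_eigenspace_iff]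
      exact hT i
  rw [hspan, finrank_span_eq_card]
  exact b.orthonormal.linearIndependent.comp _ Subtype.val_injective

/-- The logarithm of the Fredholm determinant of a positive operator that is diagonal in a Hilbert
basis. -/
lemma log_fredholmDet_of_diagonal (b : HilbertBasis ι ℝ H) {T : H →L[ℝ] H} {f : ι → ℝ}
    (hT : ∀ i, T (b i) = f i • b i) (hf : ∀ i, 0 ≤ f i) (hs : Summable f) :
    HasSum (fun i => Real.log (1 + f i)) (Real.log (fredholmDet T)) := by
  have hlog : Summable fun i => Real.log (1 + f i) := by
    refine Summable.of_nonneg_of_le (fun i => Real.log_nonneg (by linarith [hf i])) (fun i => ?_) hs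
    have := Real.log_le_sub_one_of_pos (show 0 < 1 + f i by linarith [hf i])
    linarith
  -- A summable family tends to 0 along the cofinite filter, so it takes each nonzero value finitely
  -- often.
  have hfin : ∀ μ : ℝ, μ ≠ 0 → Finite {i // f i = μ} := by
    intro μ hμ
    have h1 := hs.tendsto_cofinite_zero (IsOpen.mem_nhds (isOpen_ne (x := μ)) hμ.symm)
    rw [mem_map, mem_cofinite] at h1
    exact (h1.subset fun i hi => not_not.2 hi).to_subtype
  -- The logarithms are grouped by eigenvalue. The fibre over 0 may be infinite, but contributes log
  -- 1 = 0, like the factor (1 + 0)^m.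
  have hfib : ∀ μ : ℝ, HasSum (fun i : {i // f i = μ} => Real.log (1 + f i))
      (Real.log ((1 + μ) ^ Module.finrank ℝ (Module.End.eigenspace (T : Module.End ℝ H) μ))) := by
    intro μ
    by_cases hμ : μ = 0
    · subst hμ
      have : (fun i : {i // f i = 0} => Real.log (1 + f i)) = fun _ => 0 := by
        funext i; simp [i.2]
      rw [this]
      simp
    · have := hfin μ hμ
      have := Fintype.ofFinite {i // f i = μ}
      have h1 : (fun i : {i // f i = μ} => Real.log (1 + f i)) = fun _ => Real.log (1 + μ) := by
        funext i; rw [i.2]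
      rw [finrank_eigenspace_of_diagonal b hT hf, Real.log_pow, h1]
      simpa using hasSum_fintype fun _ : {i // f i = μ} => Real.log (1 + μ)
  have hsig := ((Equiv.sigmaFiberEquiv f).hasSum_iff.2 hlog.hasSum).sigma hfib
  have hexp := hsig.rexp
  -- Where 1 + μ might fail to be positive, the eigenspace is trivial and the exponent is 0.
  have heq : (Real.exp ∘ fun μ => Real.log
      ((1 + μ) ^ Module.finrank ℝ (Module.End.eigenspace (T : Module.End ℝ H) μ)))
      = fun μ => (1 + μ) ^ Module.finrank ℝ (Module.End.eigenspace (T : Module.End ℝ H) μ) := by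
    funext μ
    rcases lt_or_ge μ 0 with hμ | hμ
    · have : IsEmpty {i // f i = μ} := ⟨fun i => by linarith [hf i.1, i.2]⟩
      have := Fintype.ofIsEmpty (α := {i // f i = μ})
      rw [Function.comp, finrank_eigenspace_of_diagonal b hT hf]
      simp
    · exact Real.exp_log (by positivity)
  rw [heq] at hexp
  rw [fredholmDet, hexp.tprod_eq, Real.log_exp]
  exact hlog.hasSum

end InnerProduct

section DiagonalOperators

variable {H : Type*} [NormedAddCommGroup H] [InnerProductSpace ℝ H] [CompleteSpace H]
  {ι κ : Type*}

lemma opTrace_eq_of_diagonal (b : HilbertBasis ι ℝ H) {T : H →L[ℝ] H} {f : ι → ℝ}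
    (hT : ∀ i, T (b i) = f i • b i) (hf : ∀ i, 0 ≤ f i) {a : ℝ} (ha : HasSum f a) :
    opTrace T = a :=
  ((hasSum_inner_iff_of_diagonal b _ hT hf).2 ha).tsum_eq

end DiagonalOperators

end GPSinkhorn

/-! ### Hilbert–Schmidt operators and the spectral decomposition of compact operators -/

namespace GPSinkhorn

open scoped ENNReal InnerProductSpace

section HilbertSchmidt

variable {H : Type*} [NormedAddCommGroup H] [InnerProductSpace ℝ H] {ι κ : Type*}

lemma summable_prod_sq_inner {E : Type*} [NormedAddCommGroup E] [InnerProductSpace ℝ E]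
    (e : HilbertBasis κ ℝ E) {v : ι → E}
    (hv : Summable fun i => ‖v i‖ ^ 2) :
    Summable fun p : ι × κ => ⟪e p.2, v p.1⟫_ℝ ^ 2 := by
  refine (summable_prod_of_nonneg fun p => sq_nonneg _).2
    ⟨fun i => (hasSum_sq_inner e (v i)).summable, ?_⟩
  have h : ∀ i, ∑' k, ⟪e k, v i⟫_ℝ ^ 2 = ‖v i‖ ^ 2 := fun i => (hasSum_sq_inner e (v i)).tsum_eq
  exact hv.congr fun i => (h i).symm

/-- For Hilbert–Schmidt operators `A` and `B`, the Hilbert–Schmidt inner product of `A` and `B`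
agrees with that of `B*` and `A*`, computed in another Hilbert basis. -/
lemma exists_hasSum_inner_adjoint [CompleteSpace H] (b : HilbertBasis ι ℝ H)
    (e : HilbertBasis κ ℝ H) {A B : H →L[ℝ] H}
    (hA : Summable fun i => ‖A (b i)‖ ^ 2) (hB : Summable fun i => ‖B (b i)‖ ^ 2) :
    ∃ a : ℝ, HasSum (fun i => ⟪A (b i), B (b i)⟫_ℝ) a ∧
      HasSum (fun j => ⟪B.adjoint (e j), A.adjoint (e j)⟫_ℝ) a := by
  -- Absolute summability comes from |xy| ≤ x² + y². Parseval in e sums the rows, Parseval in b the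
  -- columns.
  have hs : Summable fun p : ι × κ => ⟪A (b p.1), e p.2⟫_ℝ * ⟪e p.2, B (b p.1)⟫_ℝ := by
    refine Summable.of_norm_bounded
      ((summable_prod_sq_inner e hA).add (summable_prod_sq_inner e hB)) fun p => ?_
    rw [norm_mul, Real.norm_eq_abs, Real.norm_eq_abs, real_inner_comm,
      ← sq_abs ⟪e p.2, A (b p.1)⟫_ℝ, ← sq_abs ⟪e p.2, B (b p.1)⟫_ℝ]
    nlinarith [sq_nonneg (|⟪e p.2, A (b p.1)⟫_ℝ| - |⟪e p.2, B (b p.1)⟫_ℝ|),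
      sq_nonneg (|⟪e p.2, A (b p.1)⟫_ℝ| + |⟪e p.2, B (b p.1)⟫_ℝ|)]
  refine ⟨_, hs.hasSum.prod_fiberwise fun i => e.hasSum_inner_mul_inner _ _,
    ((Equiv.prodComm κ ι).hasSum_iff.2 hs.hasSum).prod_fiberwise fun j => ?_⟩
  refine (b.hasSum_inner_mul_inner (B.adjoint (e j)) (A.adjoint (e j))).congr_fun fun i => ?_
  simp only [Function.comp, Equiv.prodComm_apply, Prod.swap, ContinuousLinearMap.adjoint_inner_left,
    ContinuousLinearMap.adjoint_inner_right]
  ring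

lemma norm_sum_inner_smul_le (e : HilbertBasis κ ℝ H) (v : κ → H) (s : Finset κ) (x : H) :
    ‖∑ k ∈ s, ⟪e k, x⟫_ℝ • v k‖ ≤ √(∑ k ∈ s, ‖v k‖ ^ 2) * ‖x‖ := by
  calc ‖∑ k ∈ s, ⟪e k, x⟫_ℝ • v k‖ ≤ ∑ k ∈ s, ‖⟪e k, x⟫_ℝ • v k‖ := norm_sum_le _ _
    _ = ∑ k ∈ s, ‖v k‖ * |⟪e k, x⟫_ℝ| := by
        refine Finset.sum_congr rfl fun k _ => ?_
        rw [norm_smul, Real.norm_eq_abs, mul_comm]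
    _ ≤ √(∑ k ∈ s, ‖v k‖ ^ 2) * √(∑ k ∈ s, |⟪e k, x⟫_ℝ| ^ 2) :=
        Real.sum_mul_le_sqrt_mul_sqrt _ _ _
    _ ≤ √(∑ k ∈ s, ‖v k‖ ^ 2) * ‖x‖ := by
        gcongr
        rw [Real.sqrt_le_left (norm_nonneg x)]
        simp only [sq_abs]
        exact sum_le_hasSum s (fun _ _ => sq_nonneg _) (hasSum_sq_inner e x)

/-- Hilbert–Schmidt operators are compact. -/
lemma isCompactOperator_of_summable [CompleteSpace H] (e : HilbertBasis κ ℝ H) {A : H →L[ℝ] H}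
    (hA : Summable fun k => ‖A (e k)‖ ^ 2) : IsCompactOperator A := by
  classical
  -- Finite-rank truncations of A. Their distance to A in operator norm is bounded by the square
  -- root of a tail of Σ ‖A eₖ‖².
  let F : Finset κ → H →L[ℝ] H := fun s => ∑ k ∈ s, (innerSL ℝ (e k)).smulRight (A (e k))
  have hF : ∀ s x, F s x = ∑ k ∈ s, ⟪e k, x⟫_ℝ • A (e k) := by
    intro s x
    simp [F]
  have hFc : ∀ s, IsCompactOperator (F s) := by
    intro s
    have h1 : ∀ k, IsCompactOperator ((innerSL ℝ (e k)).smulRight (A (e k))) := by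
      intro k
      have h2 : IsCompactOperator (innerSL ℝ (e k)) :=
        isCompactOperator_of_locallyCompactSpace_dom (innerSL ℝ (e k))
      exact h2.clm_comp (ContinuousLinearMap.toSpanSingleton ℝ (A (e k)))
    exact (compactOperator (RingHom.id ℝ) H H).sum_mem fun k _ => h1 k
  have hlim : Tendsto F atTop (𝓝 A) := by
    rw [Metric.tendsto_atTop]
    intro δ hδ
    obtain ⟨s₀, hs₀⟩ := summable_iff_vanishing_norm.1 hA ((δ / 2) ^ 2) (by positivity)
    refine ⟨s₀, fun s hs => ?_⟩
    rw [dist_eq_norm]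
    refine lt_of_le_of_lt (ContinuousLinearMap.opNorm_le_bound _ (by positivity : 0 ≤ δ / 2)
      fun x => ?_) (half_lt_self hδ)
    have hx : Tendsto (fun t => F t x) atTop (𝓝 (A x)) := by
      have h := (e.hasSum_repr x).mapL A
      simp only [map_smul, e.repr_apply_apply] at h
      simp only [hF]
      exact h
    rw [sub_apply]
    refine le_of_tendsto ((tendsto_const_nhds (x := F s x)).sub hx).norm ?_
    filter_upwards [eventually_ge_atTop s] with t ht
    rw [norm_sub_rev, hF, hF, ← Finset.sum_sdiff_eq_sub ht]
    refine (norm_sum_inner_smul_le e _ _ x).trans ?_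
    gcongr
    rw [Real.sqrt_le_left (by positivity)]
    have h := hs₀ (t \ s) (Finset.disjoint_of_subset_right hs Finset.sdiff_disjoint)
    exact (le_abs_self _).trans h.le
  exact isCompactOperator_of_tendsto hlim (Eventually.of_forall hFc)

/-- A compact self-adjoint operator is diagonal in some Hilbert basis. -/
lemma exists_hilbertBasis_diagonal.{u} {H : Type u} [NormedAddCommGroup H]
    [InnerProductSpace ℝ H] [CompleteSpace H] {T : H →L[ℝ] H} (hT : IsCompactOperator T)
    (hsym : (T : H →ₗ[ℝ] H).IsSymmetric) :
    ∃ (ι : Type u) (b : HilbertBasis ι ℝ H) (f : ι → ℝ), ∀ i, T (b i) = f i • b i := by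
  classical
  let E : ℝ → Submodule ℝ H := fun μ => Module.End.eigenspace (T : Module.End ℝ H) μ
  -- Completeness gives every eigenspace a Hilbert basis, including the possibly
  -- infinite-dimensional kernel.
  have hcomplete : ∀ μ, CompleteSpace (E μ) := by
    intro μ
    have hcl : IsClosed (E μ : Set H) := by
      have : (E μ : Set H) = {x | T x = μ • x} := by
        ext x
        exact Module.End.mem_eigenspace_iff
      rw [this]
      exact isClosed_eq T.continuous (continuous_const_smul μ)
    exact hcl.completeSpace_coe
  choose w b hb using fun μ => exists_hilbertBasis ℝ (E μ)
  let v : (Σ μ, w μ) → H := fun a => (b a.1 a.2 : H)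
  have hv : Orthonormal ℝ v :=
    hsym.orthogonalFamily_eigenspaces.orthonormal_sigma_orthonormal
      (v_family := fun μ i => b μ i) fun μ => (b μ).orthonormal
  have hTv : ∀ a, T (v a) = a.1 • v a := fun a =>
    Module.End.mem_eigenspace_iff.1 (b a.1 a.2).2
  have hbot : (Submodule.span ℝ (Set.range v))ᗮ = ⊥ := by
    rw [eq_bot_iff, ← ContinuousLinearMap.orthogonalComplement_iSup_eigenspaces_eq_bot hT hsym]
    rw [← Submodule.iInf_orthogonal]
    intro x hx
    refine (Submodule.mem_iInf _).2 fun μ => (Submodule.mem_orthogonal' _ _).2 fun y hy => ?_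
    have h0 : ∀ i, ⟪x, (b μ i : H)⟫_ℝ = 0 := fun i => by
      rw [real_inner_comm]
      exact hx _ (Submodule.subset_span ⟨⟨μ, i⟩, rfl⟩)
    have h1 := (((b μ).hasSum_repr ⟨y, hy⟩).mapL (E μ).subtypeL).mapL (innerSL ℝ x)
    refine h1.unique ?_
    simp only [map_smul, Submodule.subtypeL_apply, innerSL_apply_apply, h0, smul_zero]
    exact hasSum_zero
  refine ⟨_, HilbertBasis.mkOfOrthogonalEqBot hv hbot, fun a => a.1, fun a => ?_⟩
  rw [HilbertBasis.coe_mkOfOrthogonalEqBot]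
  exact hTv a

lemma nonneg_of_isPositive_of_diagonal (b : HilbertBasis ι ℝ H) {T : H →L[ℝ] H} (hT : T.IsPositive)
    {f : ι → ℝ} (hf : ∀ i, T (b i) = f i • b i) (i : ι) : 0 ≤ f i := by
  have h : 0 ≤ ⟪T (b i), b i⟫_ℝ := hT.inner_nonneg_left (b i)
  rwa [hf, inner_smul_left, real_inner_self_eq_norm_sq, b.orthonormal.1 i, one_pow, mul_one] at h

end HilbertSchmidt

/-! ### Entropic distance and trace moments through eigenvalues -/

section OperatorFormula

variable {H : Type*} [NormedAddCommGroup H] [InnerProductSpace ℝ H] [CompleteSpace H] {ι κ : Type*}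

/-- The entropic Wasserstein distance in terms of the eigenvalues of `A^{1/2} B A^{1/2}`. -/
lemma opEntropicW2Sq_eq_of_diagonal (b : HilbertBasis ι ℝ H) {A B : H →L[ℝ] H} {lam : ι → ℝ}
    (hb : ∀ i, (opSqrt A ∘L B ∘L opSqrt A) (b i) = lam i • b i) (hlam : ∀ i, 0 ≤ lam i)
    (hs : Summable lam) {ε : ℝ} :
    opEntropicW2Sq ε A B
      = opTrace A + opTrace B - ε / 2 * ∑' i, scalarF (16 / ε ^ 2 * lam i) := by
  set c : ℝ := 16 / ε ^ 2 with hc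
  have hc0 : 0 ≤ c := by positivity
  have hpos : ∀ i, 0 ≤ c * lam i := fun i => mul_nonneg hc0 (hlam i)
  have hM : ∀ i, opM ε A B (b i) = (√(1 + c * lam i) - 1) • b i := by
    intro i
    have h1 : ∀ i, (ContinuousLinearMap.id ℝ H + c • (opSqrt A ∘L B ∘L opSqrt A)) (b i)
        = (1 + c * lam i) • b i := by
      intro i
      rw [add_apply, smul_apply, hb, ContinuousLinearMap.id_apply, smul_smul, add_smul, one_smul]
    rw [opM, add_apply, opSqrt_apply_of_diagonal b h1 fun i => by linarith [hpos i], neg_apply,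
      ContinuousLinearMap.id_apply, sub_smul, one_smul]
    abel
  have hm0 : ∀ i, 0 ≤ √(1 + c * lam i) - 1 := fun i => by
    rw [sub_nonneg, Real.one_le_sqrt]
    linarith [hpos i]
  have hms : Summable fun i => √(1 + c * lam i) - 1 := by
    refine Summable.of_nonneg_of_le hm0 (fun i => ?_) (hs.mul_left c)
    have := Real.sq_sqrt (show 0 ≤ 1 + c * lam i by linarith [hpos i])
    nlinarith [hm0 i]
  have htr : opTrace (opM ε A B) = ∑' i, (√(1 + c * lam i) - 1) :=
    opTrace_eq_of_diagonal b hM hm0 hms.hasSum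
  have hM2 : ∀ i, ((1 / 2 : ℝ) • opM ε A B) (b i) = (1 / 2 * (√(1 + c * lam i) - 1)) • b i := by
    intro i
    rw [smul_apply, hM, smul_smul]
  have hdet := log_fredholmDet_of_diagonal b hM2
    (fun i => mul_nonneg (by norm_num) (hm0 i)) (hms.mul_left _)
  have hF : ∀ i, scalarF (c * lam i) = (√(1 + c * lam i) - 1)
      - Real.log (1 + 1 / 2 * (√(1 + c * lam i) - 1)) := by
    intro i
    rw [scalarF]
    congr 2
    ring
  rw [opEntropicW2Sq, htr, ← hdet.tsum_eq]
  simp_rw [hF]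
  rw [hms.tsum_sub hdet.summable]
  ring

/-- For positive compact `A`, `B` with `A` of trace class, there are numbers which determine the
entropic Wasserstein distance and whose power sums are the traces of the powers of `B A`. -/
lemma exists_opEntropicW2Sq_eq.{u} {H : Type u} [NormedAddCommGroup H] [InnerProductSpace ℝ H]
    [CompleteSpace H] {A B : H →L[ℝ] H} (hA : A.IsPositive) (hB : B.IsPositive)
    (hAc : IsCompactOperator A) (hBc : IsCompactOperator B) (e : HilbertBasis κ ℝ H)
    (htr : Summable fun k => ⟪A (e k), e k⟫_ℝ) :
    ∃ (ι : Type u) (lam : ι → ℝ), (∀ i, 0 ≤ lam i) ∧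
      (∀ ε : ℝ, opEntropicW2Sq ε A B
        = opTrace A + opTrace B - ε / 2 * ∑' i, scalarF (16 / ε ^ 2 * lam i)) ∧
      ∀ k : ℕ, ∃ a : ℝ, HasSum (fun i => lam i ^ (k + 1)) a ∧
        HasSum (fun j => ⟪((B * A) ^ (k + 1)) (e j), e j⟫_ℝ) a := by
  obtain ⟨ι₀, b₀, f₀, hb₀⟩ := exists_hilbertBasis_diagonal hAc hA.1
  have hf₀ := nonneg_of_isPositive_of_diagonal b₀ hA hb₀
  obtain ⟨hS, hSS⟩ := opSqrt_spec_of_diagonal b₀ hb₀ hf₀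
  set S := opSqrt A with hSdef
  have hSsym : ∀ x y, ⟪S x, y⟫_ℝ = ⟪x, S y⟫_ℝ := hS.1
  have hT : (S ∘L B ∘L S).IsPositive := by
    refine ⟨fun x y => ?_, fun x => ?_⟩
    · change ⟪S (B (S x)), y⟫_ℝ = ⟪x, S (B (S y))⟫_ℝ
      exact (hSsym _ _).trans ((hB.1 _ _).trans (hSsym _ _))
    · have h : 0 ≤ ⟪S (B (S x)), x⟫_ℝ := by
        rw [hSsym]
        exact hB.inner_nonneg_left _
      simpa [ContinuousLinearMap.reApplyInnerSelf_apply] using h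
  have hTc : IsCompactOperator (S ∘L B ∘L S) := (hBc.comp_clm S).clm_comp S
  obtain ⟨ι, b, lam, hb⟩ := exists_hilbertBasis_diagonal hTc hT.1
  have hlam := nonneg_of_isPositive_of_diagonal b hT hb
  -- Tr A is the squared Hilbert–Schmidt norm of S = A^{1/2}; it is carried from e to b through the
  -- eigenbasis b₀ of A.
  have hSb : Summable fun i => ‖S (b i)‖ ^ 2 := by
    have h1 := (hasSum_inner_iff_of_diagonal b₀ b hb₀ hf₀).2
      ((hasSum_inner_iff_of_diagonal b₀ e hb₀ hf₀).1 htr.hasSum)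
    refine h1.summable.congr fun i => ?_
    rw [← real_inner_self_eq_norm_sq, hSsym, real_inner_comm, ← ContinuousLinearMap.comp_apply, hSS]
  have hmom : ∀ k : ℕ, ∃ a : ℝ, HasSum (fun i => lam i ^ (k + 1)) a ∧
        HasSum (fun j => ⟪((B * A) ^ (k + 1)) (e j), e j⟫_ℝ) a := by
    intro k
    -- Here (SBS)ᵏ⁺¹ = S Q S and (BA)ᵏ⁺¹ = Q S S. Both traces are the Hilbert–Schmidt pairing of QS
    -- with S, in b and in e, which is the required cyclicity.
    set Q : H →L[ℝ] H := (B * A) ^ k * B with hQ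
    have hQS : Summable fun i => ‖(Q * S) (b i)‖ ^ 2 := by
      refine Summable.of_nonneg_of_le (fun i => sq_nonneg _) (fun i => ?_) (hSb.mul_left (‖Q‖ ^ 2))
      rw [← mul_pow]
      gcongr
      exact Q.le_opNorm _
    obtain ⟨a, ha, ha'⟩ := exists_hasSum_inner_adjoint b e hQS hSb
    have hSS' : S * S = A := hSS
    have hSadj : S.adjoint = S := hS.isSelfAdjoint.adjoint_eq
    refine ⟨a, ha.congr_fun fun i => ?_, ha'.congr_fun fun j => ?_⟩
    · have hpow : ∀ k : ℕ, (S * B * S) ^ (k + 1) = S * ((B * A) ^ k * B) * S := by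
        intro k
        induction k with
        | zero => simp
        | succ k ih => rw [pow_succ, ih, pow_succ (B * A), ← hSS']; simp only [mul_assoc]
      have hpow' : ∀ k : ℕ, ((S * B * S) ^ k) (b i) = lam i ^ k • b i := by
        intro k
        induction k with
        | zero => simp
        | succ k ih =>
          have h := hb i
          rw [pow_succ', mul_apply_eq_comp, ih, map_smul, pow_succ, mul_smul, ← h]
          rfl
      have h := congrArg (fun x => ⟪x, b i⟫_ℝ) (hpow' (k + 1))
      simp only [inner_smul_left, real_inner_self_eq_norm_sq, b.orthonormal.1 i, conj_trivial, one_pow,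
        mul_one] at h
      erw [hpow] at h
      rw [← hSsym]
      exact h.symm
    · rw [hSadj, ContinuousLinearMap.adjoint_inner_right]
      have h : (B * A) ^ (k + 1) = Q * S * S := by
        rw [hQ, mul_assoc, hSS', pow_succ, mul_assoc]
      rw [h]
      rfl
  refine ⟨ι, lam, hlam, fun ε => opEntropicW2Sq_eq_of_diagonal b hb hlam ?_, hmom⟩
  obtain ⟨a, ha, -⟩ := hmom 0
  simpa using ha.summable

end OperatorFormula

end GPSinkhorn

/-! ### Covariance operators -/

namespace GPSinkhorn

open scoped ENNReal InnerProductSpace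

/-- Orthonormal vectors are √2 apart, so balls of radius 1/2 around them are disjoint. Countability
is needed to exchange sums with integrals. -/
lemma countable_of_hilbertBasis {ι E : Type*} [NormedAddCommGroup E] [InnerProductSpace ℝ E]
    [TopologicalSpace.SeparableSpace E] (b : HilbertBasis ι ℝ E) : Countable ι := by
  refine Pairwise.countable_of_isOpen_disjoint (s := fun i => Metric.ball (b i) (1 / 2)) ?_
    (fun i => Metric.isOpen_ball) (fun i => Metric.nonempty_ball.2 (by norm_num))
  intro i j hij
  refine Metric.ball_disjoint_ball ?_
  have h : ‖b i - b j‖ ^ 2 = 2 := by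
    rw [norm_sub_sq_real, b.orthonormal.1 i, b.orthonormal.1 j, b.orthonormal.2 hij]
    norm_num
  rw [dist_eq_norm]
  nlinarith [norm_nonneg (b i - b j)]

/-! ### Feature maps of covariance kernels -/

section FeatureMap

/-- A covariance kernel is the Gram kernel of a map into a Hilbert space with total range. -/
lemma exists_featureMap.{u} {X : Type u} [TopologicalSpace X] {K : C(X × X, ℝ)}
    (hK : IsCovarianceKernel K) :
    ∃ (E : Type u) (_ : NormedAddCommGroup E) (_ : InnerProductSpace ℝ E) (_ : CompleteSpace E)
      (Φ : X → E), (∀ x y, ⟪Φ x, Φ y⟫_ℝ = K (x, y)) ∧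
        (Submodule.span ℝ (Set.range Φ)).topologicalClosure = ⊤ := by
  have hsym : ∀ x y, K (x, y) = K (y, x) := by
    intro x y
    have h := (hK 2 ![x, y]).isHermitian.apply 0 1
    simpa using h.symm
  -- The reproducing-kernel construction takes operator-valued kernels, so K enters as multiples of
  -- the identity of ℝ.
  let M : Matrix X X (ℝ →L[ℝ] ℝ) := Matrix.of fun x y => K (x, y) • 1
  have hM : M.PosSemidef := by
    have htfae := (RKHS.posSemidef_tfae (𝕜 := ℝ) (K := M)).out 0 2
    refine htfae.2 ⟨?_, fun v => ?_⟩
    · ext x y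
      simp [M, hsym x y]
    · let σ := v.support.equivFin.symm
      have h := (hK _ fun i => (σ i : X)).dotProduct_mulVec_nonneg fun i => v (σ i)
      have hsum : ∀ g : X → ℝ, ∑ x ∈ v.support, g x = ∑ i, g (σ i) := fun g => by
        rw [← Finset.sum_coe_sort, ← Equiv.sum_comp σ]
      simp only [Finsupp.sum, hsum, RCLike.re_to_real]
      refine h.trans_eq ?_
      simp only [dotProduct, Matrix.mulVec, Finset.mul_sum]
      rw [Finset.sum_comm]
      refine Finset.sum_congr rfl fun i _ => Finset.sum_congr rfl fun j _ => ?_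
      simp [M]
  have : Fact M.PosSemidef := ⟨hM⟩
  refine ⟨RKHS.OfKernel M, inferInstance, inferInstance, inferInstance,
    fun x => RKHS.kerFun (RKHS.OfKernel M) x 1, fun x y => ?_, ?_⟩
  · rw [← RKHS.kernel_inner, RKHS.OfKernel.kernel_ofKernel]
    simp [M, hsym x y]
  · rw [eq_top_iff, ← RKHS.kerFun_dense]
    refine Submodule.topologicalClosure_mono (Submodule.span_le.2 ?_)
    rintro _ ⟨x, v, rfl⟩
    have h : RKHS.kerFun (RKHS.OfKernel M) x v = v • RKHS.kerFun (RKHS.OfKernel M) x 1 := by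
      rw [← map_smul, smul_eq_mul, mul_one]
    rw [h]
    exact Submodule.smul_mem _ _ (Submodule.subset_span ⟨x, rfl⟩)

/-- ‖Φ y - Φ x‖² = K(y,y) - 2K(y,x) + K(x,x) is continuous in y and vanishes at y = x. -/
lemma continuous_featureMap {X E : Type*} [TopologicalSpace X] [NormedAddCommGroup E]
    [InnerProductSpace ℝ E] {K : C(X × X, ℝ)} {Φ : X → E} (hΦ : ∀ x y, ⟪Φ x, Φ y⟫_ℝ = K (x, y)) :
    Continuous Φ := by
  refine continuous_iff_continuousAt.2 fun x => tendsto_iff_norm_sub_tendsto_zero.2 ?_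
  have h : ∀ y, ‖Φ y - Φ x‖ = √(K (y, y) - 2 * K (y, x) + K (x, x)) := by
    intro y
    rw [← hΦ, ← hΦ, ← hΦ, real_inner_self_eq_norm_sq, real_inner_self_eq_norm_sq,
      ← norm_sub_sq_real, Real.sqrt_sq (norm_nonneg _)]
  simp only [h]
  have hc : Continuous fun y => √(K (y, y) - 2 * K (y, x) + K (x, x)) := by fun_prop
  have h0 := hc.tendsto x
  have hx : K (x, x) - 2 * K (x, x) + K (x, x) = 0 := by ring
  rwa [hx, Real.sqrt_zero] at h0

lemma separableSpace_of_span_dense {X E : Type*} [TopologicalSpace X]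
    [TopologicalSpace.SeparableSpace X] [NormedAddCommGroup E] [InnerProductSpace ℝ E] {Φ : X → E}
    (hΦ : Continuous Φ) (h : (Submodule.span ℝ (Set.range Φ)).topologicalClosure = ⊤) :
    TopologicalSpace.SeparableSpace E := by
  have h1 := ((TopologicalSpace.isSeparable_range hΦ).span (R := ℝ)).closure
  rw [← Submodule.topologicalClosure_coe, h, Submodule.top_coe] at h1
  exact TopologicalSpace.isSeparable_univ_iff.1 h1

end FeatureMap

/-! ### Trace formulas for integral operators -/

section CovarianceOperator

lemma integrable_coe_Lp {X : Type*} [MeasurableSpace X] (ρ : Measure X) [IsProbabilityMeasure ρ]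
    (φ : Lp ℝ 2 ρ) : Integrable φ ρ :=
  (Lp.memLp φ).integrable (by norm_num)

lemma integrable_kernel_mul {X : Type*} [TopologicalSpace X] [CompactSpace X]
    [SecondCountableTopology X] [MeasurableSpace X] [BorelSpace X] (ρ : Measure X) [SFinite ρ]
    (K : C(X × X, ℝ)) {u v : X → ℝ} (hu : Integrable u ρ) (hv : Integrable v ρ) :
    Integrable (fun p : X × X => K p * (u p.1 * v p.2)) (ρ.prod ρ) :=
  (hu.mul_prod hv).bdd_mul (c := ‖K‖) K.continuous.aestronglyMeasurable
    (Eventually.of_forall fun p => K.norm_coe_le_norm p)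

lemma countable_of_hilbertBasis_Lp {X : Type*} [TopologicalSpace X] [SecondCountableTopology X]
    [MeasurableSpace X] [BorelSpace X] (ρ : Measure X) [IsProbabilityMeasure ρ] {κ : Type*}
    (e : HilbertBasis κ ℝ (Lp ℝ 2 ρ)) : Countable κ := by
  have : Fact ((2 : ℝ≥0∞) ≠ ∞) := ⟨by norm_num⟩
  exact countable_of_hilbertBasis e

variable {X : Type*} [TopologicalSpace X] [CompactSpace X]
  [MeasurableSpace X] [BorelSpace X] (ρ : Measure X) [IsProbabilityMeasure ρ]

lemma integrable_of_continuous {f : X → ℝ} (hf : Continuous f) : Integrable f ρ :=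
  hf.integrable_of_hasCompactSupport (HasCompactSupport.of_compactSpace f)

lemma inner_covarianceOperator (K : C(X × X, ℝ)) (φ ψ : Lp ℝ 2 ρ) :
    ⟪covarianceOperator ρ K φ, ψ⟫_ℝ = ∫ x, (∫ s, K (x, s) * φ s ∂ρ) * ψ x ∂ρ := by
  rw [L2.inner_def]
  refine integral_congr_ae ?_
  filter_upwards [covarianceOperator_apply_ae ρ K φ] with x hx
  rw [hx]
  simp [mul_comm]

/-- The transpose of a kernel. -/
def kernelSwap (K : C(X × X, ℝ)) : C(X × X, ℝ) := K.comp ContinuousMap.prodSwap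

/-- The section `K(x, ·)` of a kernel, as an element of `L²`. -/
noncomputable def kernelSection (K : C(X × X, ℝ)) (x : X) : Lp ℝ 2 ρ := ContinuousMap.toLp 2 ρ ℝ (K.curry x)

lemma continuous_kernelSection (K : C(X × X, ℝ)) : Continuous (kernelSection ρ K) := by
  unfold kernelSection
  fun_prop

lemma covarianceOperator_ae_inner (K : C(X × X, ℝ)) (φ : Lp ℝ 2 ρ) :
    covarianceOperator ρ K φ =ᵐ[ρ] fun x => ⟪φ, kernelSection ρ K x⟫_ℝ := by
  filter_upwards [covarianceOperator_apply_ae ρ K φ] with x hx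
  rw [hx]
  exact kernelIntegral_eq_inner ρ K φ x

lemma inner_toLp (f g : C(X, ℝ)) :
    ⟪ContinuousMap.toLp 2 ρ ℝ f, ContinuousMap.toLp 2 ρ ℝ g⟫_ℝ = ∫ x, f x * g x ∂ρ := by
  rw [L2.inner_def]
  refine integral_congr_ae ?_
  filter_upwards [ContinuousMap.coeFn_toLp (p := 2) ρ (𝕜 := ℝ) f,
    ContinuousMap.coeFn_toLp (p := 2) ρ (𝕜 := ℝ) g] with x hf hg
  rw [hf, hg]
  simp [mul_comm]

variable [SecondCountableTopology X]

lemma inner_covarianceOperator_swap (K : C(X × X, ℝ)) (φ ψ : Lp ℝ 2 ρ) :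
    ⟪covarianceOperator ρ K φ, ψ⟫_ℝ = ⟪φ, covarianceOperator ρ (kernelSwap K) ψ⟫_ℝ := by
  rw [real_inner_comm _ φ, inner_covarianceOperator, inner_covarianceOperator]
  simp_rw [← integral_mul_const]
  rw [integral_integral_swap]
  · refine integral_congr_ae (Eventually.of_forall fun s => integral_congr_ae
      (Eventually.of_forall fun x => ?_))
    simp only [kernelSwap, ContinuousMap.comp_apply, ContinuousMap.prodSwap_apply]
    ring
  · refine (integrable_kernel_mul ρ K (integrable_coe_Lp ρ ψ) (integrable_coe_Lp ρ φ)).congr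
      (Eventually.of_forall fun p => ?_)
    simp only [Function.uncurry]
    ring

/-- The trace of a product of two integral operators with continuous kernels. -/
lemma hasSum_inner_covarianceOperator_mul {κ : Type*} (e : HilbertBasis κ ℝ (Lp ℝ 2 ρ))
    (G K : C(X × X, ℝ)) :
    HasSum (fun k => ⟪covarianceOperator ρ G (covarianceOperator ρ K (e k)), e k⟫_ℝ)
      (∫ x, ∫ s, K (x, s) * G (s, x) ∂ρ ∂ρ) := by
  have : Countable κ := countable_of_hilbertBasis_Lp ρ e
  -- With G moved to the other side, each term integrates a product of coefficients of K(x,·) and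
  -- G(·,x). Parseval sums these pointwise in x; |ab| ≤ a² + b² gives a dominating series with
  -- continuous sum.
  have h1 : ∀ k, ⟪covarianceOperator ρ G (covarianceOperator ρ K (e k)), e k⟫_ℝ
      = ∫ x, ⟪kernelSection ρ K x, e k⟫_ℝ * ⟪e k, kernelSection ρ (kernelSwap G) x⟫_ℝ ∂ρ := by
    intro k
    rw [inner_covarianceOperator_swap, L2.inner_def]
    refine integral_congr_ae ?_
    filter_upwards [covarianceOperator_ae_inner ρ K (e k),
      covarianceOperator_ae_inner ρ (kernelSwap G) (e k)] with x hx hx'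
    rw [hx, hx', real_inner_comm (e k) (kernelSection ρ K x), RCLike.inner_apply, conj_trivial,
      mul_comm]
  simp_rw [h1]
  have hcK := continuous_kernelSection ρ K
  have hcG := continuous_kernelSection ρ (kernelSwap G)
  have hbound : ∀ x, HasSum (fun k => ⟪e k, kernelSection ρ K x⟫_ℝ ^ 2
      + ⟪e k, kernelSection ρ (kernelSwap G) x⟫_ℝ ^ 2)
      (‖kernelSection ρ K x‖ ^ 2 + ‖kernelSection ρ (kernelSwap G) x‖ ^ 2) := fun x =>
    (hasSum_sq_inner e _).add (hasSum_sq_inner e _)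
  refine hasSum_integral_of_dominated_convergence
    (fun k x => ⟪e k, kernelSection ρ K x⟫_ℝ ^ 2
      + ⟪e k, kernelSection ρ (kernelSwap G) x⟫_ℝ ^ 2)
    (fun k => ?_) (fun k => Eventually.of_forall fun x => ?_)
    (Eventually.of_forall fun x => (hbound x).summable) ?_ (Eventually.of_forall fun x => ?_)
  · exact (by fun_prop : Continuous fun x => ⟪kernelSection ρ K x, e k⟫_ℝ
      * ⟪e k, kernelSection ρ (kernelSwap G) x⟫_ℝ).aestronglyMeasurable
  · rw [real_inner_comm, norm_mul, Real.norm_eq_abs, Real.norm_eq_abs,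
      ← sq_abs ⟪e k, kernelSection ρ K x⟫_ℝ, ← sq_abs ⟪e k, kernelSection ρ (kernelSwap G) x⟫_ℝ]
    nlinarith [sq_nonneg (|⟪e k, kernelSection ρ K x⟫_ℝ|
      - |⟪e k, kernelSection ρ (kernelSwap G) x⟫_ℝ|),
      sq_nonneg (|⟪e k, kernelSection ρ K x⟫_ℝ| + |⟪e k, kernelSection ρ (kernelSwap G) x⟫_ℝ|)]
  · simp_rw [fun x => (hbound x).tsum_eq]
    exact integrable_of_continuous ρ (by fun_prop)
  · have h := e.hasSum_inner_mul_inner (kernelSection ρ K x) (kernelSection ρ (kernelSwap G) x)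
    rw [kernelSection, kernelSection, inner_toLp] at h
    exact h

/-- Integral operators with continuous kernels are Hilbert–Schmidt, hence compact. -/
lemma isCompactOperator_covarianceOperator (K : C(X × X, ℝ)) :
    IsCompactOperator (covarianceOperator ρ K) := by
  obtain ⟨w, e, -⟩ := exists_hilbertBasis ℝ (Lp ℝ 2 ρ)
  refine isCompactOperator_of_summable e ?_
  refine (hasSum_inner_covarianceOperator_mul ρ e (kernelSwap K) K).summable.congr fun k => ?_
  rw [← real_inner_self_eq_norm_sq, inner_covarianceOperator_swap]
  rfl

variable {ρ}

lemma integrable_smul_featureMap {E : Type*} [NormedAddCommGroup E] {Φ : X → E} [NormedSpace ℝ E]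
    (hΦ : Continuous Φ) (φ : Lp ℝ 2 ρ) : Integrable (fun s => φ s • Φ s) ρ := by
  obtain ⟨C, hC⟩ := (isCompact_univ.image hΦ).isBounded.exists_norm_le
  exact (integrable_coe_Lp ρ φ).smul_bdd C hΦ.aestronglyMeasurable
    (Eventually.of_forall fun x => hC _ ⟨x, Set.mem_univ x, rfl⟩)

/-- The quadratic form of a covariance operator is the squared norm of a vector-valued integral. -/
lemma inner_covarianceOperator_eq_norm_sq {E : Type*} [NormedAddCommGroup E]
    [InnerProductSpace ℝ E] [CompleteSpace E] {K : C(X × X, ℝ)} {Φ : X → E}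
    (hΦ : ∀ x y, ⟪Φ x, Φ y⟫_ℝ = K (x, y)) (φ : Lp ℝ 2 ρ) :
    ⟪covarianceOperator ρ K φ, φ⟫_ℝ = ‖∫ s, φ s • Φ s ∂ρ‖ ^ 2 := by
  have hint := integrable_smul_featureMap (continuous_featureMap hΦ) φ
  have h : ∀ c : E, ∫ s, ⟪c, Φ s⟫_ℝ * φ s ∂ρ = ⟪c, ∫ s, φ s • Φ s ∂ρ⟫_ℝ := by
    intro c
    rw [← integral_inner hint]
    refine integral_congr_ae (Eventually.of_forall fun s => ?_)
    simp only [inner_smul_right]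
    ring
  rw [inner_covarianceOperator, ← real_inner_self_eq_norm_sq, ← h]
  refine integral_congr_ae (Eventually.of_forall fun x => ?_)
  simp only
  rw [real_inner_comm, ← h]
  simp only [hΦ]

/-- The trace of a covariance operator is the integral of the kernel over the diagonal. -/
lemma hasSum_inner_covarianceOperator {K : C(X × X, ℝ)} (hK : IsCovarianceKernel K) {κ : Type*}
    (e : HilbertBasis κ ℝ (Lp ℝ 2 ρ)) :
    HasSum (fun k => ⟪covarianceOperator ρ K (e k), e k⟫_ℝ) (∫ x, K (x, x) ∂ρ) := by
  obtain ⟨E, _, _, _, Φ, hΦ, hspan⟩ := exists_featureMap hK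
  have hc := continuous_featureMap hΦ
  have := separableSpace_of_span_dense hc hspan
  obtain ⟨w, h, -⟩ := exists_hilbertBasis ℝ E
  have : Countable w := countable_of_hilbertBasis h
  -- These play the role of Mercer functions: K(x,y) = Σⱼ uⱼ(x)uⱼ(y). The trace becomes Σⱼ Σₖ ⟪eₖ,
  -- uⱼ⟫² = Σⱼ ‖uⱼ‖² = ∫ K(x,x).
  let u : w → C(X, ℝ) := fun j => ⟨fun x => ⟪h j, Φ x⟫_ℝ, by fun_prop⟩
  have hdiag : ∀ x, ‖Φ x‖ ^ 2 = K (x, x) := fun x => by rw [← hΦ, real_inner_self_eq_norm_sq]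
  have hu : ∀ (j : w) (φ : Lp ℝ 2 ρ),
      ⟪h j, ∫ s, φ s • Φ s ∂ρ⟫_ℝ = ⟪φ, ContinuousMap.toLp 2 ρ ℝ (u j)⟫_ℝ := by
    intro j φ
    rw [← integral_inner (integrable_smul_featureMap hc φ), L2.inner_def]
    refine integral_congr_ae ?_
    filter_upwards [ContinuousMap.coeFn_toLp (p := 2) ρ (𝕜 := ℝ) (u j)] with s hs
    rw [hs, inner_smul_right]
    simp [u, mul_comm]
  have hpos : ∀ k, 0 ≤ ⟪covarianceOperator ρ K (e k), e k⟫_ℝ := fun k => by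
    rw [inner_covarianceOperator_eq_norm_sq hΦ]
    exact sq_nonneg _
  have hKpos : ∀ x, 0 ≤ K (x, x) := fun x => hdiag x ▸ sq_nonneg _
  rw [hasSum_iff_tsum_ofReal hpos (integral_nonneg hKpos)]
  have h1 : ∀ k, ENNReal.ofReal ⟪covarianceOperator ρ K (e k), e k⟫_ℝ
      = ∑' j, ENNReal.ofReal (⟪e k, ContinuousMap.toLp 2 ρ ℝ (u j)⟫_ℝ ^ 2) := by
    intro k
    rw [inner_covarianceOperator_eq_norm_sq hΦ, ← (hasSum_iff_tsum_ofReal (fun _ => sq_nonneg _)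
      (sq_nonneg _)).1 (hasSum_sq_inner h _)]
    simp only [hu]
  simp_rw [h1]
  rw [ENNReal.tsum_comm]
  have h2 : ∀ j, ∑' k, ENNReal.ofReal (⟪e k, ContinuousMap.toLp 2 ρ ℝ (u j)⟫_ℝ ^ 2)
      = ∫⁻ x, ENNReal.ofReal (⟪h j, Φ x⟫_ℝ ^ 2) ∂ρ := by
    intro j
    rw [(hasSum_iff_tsum_ofReal (fun _ => sq_nonneg _) (sq_nonneg _)).1 (hasSum_sq_inner e _),
      ← real_inner_self_eq_norm_sq, inner_toLp,
      ofReal_integral_eq_lintegral_ofReal (integrable_of_continuous ρ (by fun_prop))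
        (Eventually.of_forall fun x => mul_self_nonneg _)]
    simp only [u, ContinuousMap.coe_mk, sq]
  simp_rw [h2]
  rw [← lintegral_tsum, ofReal_integral_eq_lintegral_ofReal
    (integrable_of_continuous ρ (by fun_prop)) (Eventually.of_forall hKpos)]
  · refine lintegral_congr fun x => ?_
    rw [(hasSum_iff_tsum_ofReal (fun _ => sq_nonneg _) (sq_nonneg _)).1 (hasSum_sq_inner h (Φ x)),
      hdiag]
  · intro j
    exact (ENNReal.continuous_ofReal.comp
      (by fun_prop : Continuous fun x => ⟪h j, Φ x⟫_ℝ ^ 2)).aemeasurable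

lemma isPositive_covarianceOperator {K : C(X × X, ℝ)} (hK : IsCovarianceKernel K) :
    (covarianceOperator ρ K).IsPositive := by
  obtain ⟨E, _, _, _, Φ, hΦ, -⟩ := exists_featureMap hK
  have hswap : kernelSwap K = K := by
    ext ⟨x, y⟩
    simp only [kernelSwap, ContinuousMap.comp_apply, ContinuousMap.prodSwap_apply]
    rw [← hΦ, ← hΦ, real_inner_comm]
  refine ⟨fun φ ψ => ?_, fun φ => ?_⟩
  · have h := inner_covarianceOperator_swap ρ K φ ψ
    rwa [hswap] at h
  · have h : 0 ≤ ⟪covarianceOperator ρ K φ, φ⟫_ℝ := by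
      rw [inner_covarianceOperator_eq_norm_sq hΦ]
      exact sq_nonneg _
    simpa [ContinuousLinearMap.reApplyInnerSelf_apply] using h

end CovarianceOperator


end GPSinkhorn

/-! ### Composition of kernels and empirical averages -/

namespace GPSinkhorn

open scoped ENNReal InnerProductSpace

section KernelComposition

variable {X : Type*} [TopologicalSpace X]

/-- The function `(x, y) ↦ G(x, ·) K(·, y)`. -/
def kernelPairing (G K : C(X × X, ℝ)) : C(X × X, C(X, ℝ)) :=
  ContinuousMap.curry ⟨fun p => G (p.1.1, p.2) * K (p.2, p.1.2), by fun_prop⟩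

/-- The composition of two kernels along a linear functional `L` (in place of an integral). -/
def kernelComp [CompactSpace X] (L : C(X, ℝ) →L[ℝ] ℝ) (G K : C(X × X, ℝ)) : C(X × X, ℝ) :=
  ContinuousMap.comp ⟨L, L.continuous⟩ (kernelPairing G K)

/-- The diagonal of a kernel. -/
def kernelDiag (K : C(X × X, ℝ)) : C(X, ℝ) := K.comp ⟨fun x => (x, x), by fun_prop⟩

lemma continuous_kernelDiag : Continuous (kernelDiag : C(X × X, ℝ) → C(X, ℝ)) :=
  ContinuousMap.continuous_precomp _

variable [CompactSpace X]

lemma continuous_kernelPairing [T2Space X] : Continuous fun p : C(X × X, ℝ) × C(X × X, ℝ) =>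
    kernelPairing p.1 p.2 := by
  let α : C((X × X) × X, X × X) := ⟨fun p => (p.1.1, p.2), by fun_prop⟩
  let β : C((X × X) × X, X × X) := ⟨fun p => (p.2, p.1.2), by fun_prop⟩
  have h : Continuous fun p : C(X × X, ℝ) × C(X × X, ℝ) => p.1.comp α * p.2.comp β :=
    ((ContinuousMap.continuous_precomp α).comp continuous_fst).mul
      ((ContinuousMap.continuous_precomp β).comp continuous_snd)
  exact ContinuousMap.continuous_curry.comp h

/-- Pointwise convergence of contractive functionals is uniform on continuous families. -/
lemma tendsto_comp_of_tendsto_pointwise {Y : Type*} [TopologicalSpace Y] [CompactSpace Y]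
    {L : ℕ → C(X, ℝ) →L[ℝ] ℝ} {L₀ : C(X, ℝ) →L[ℝ] ℝ} (hL : ∀ n, ‖L n‖ ≤ 1)
    (hlim : ∀ f, Tendsto (fun n => L n f) atTop (𝓝 (L₀ f))) {F : ℕ → C(Y, C(X, ℝ))}
    {F₀ : C(Y, C(X, ℝ))} (hF : Tendsto F atTop (𝓝 F₀)) :
    Tendsto (fun n => ContinuousMap.comp ⟨L n, (L n).continuous⟩ (F n)) atTop
      (𝓝 (ContinuousMap.comp ⟨L₀, L₀.continuous⟩ F₀)) := by
  have hle : ∀ n f g, dist (L n f) (L n g) ≤ dist f g := fun n f g => by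
    rw [dist_eq_norm, dist_eq_norm, ← map_sub]
    exact (L n).le_of_opNorm_le (hL n) _ |>.trans (one_mul _).le
  have h1 : Tendsto (fun n => ContinuousMap.comp ⟨L n, (L n).continuous⟩ F₀) atTop
      (𝓝 (ContinuousMap.comp ⟨L₀, L₀.continuous⟩ F₀)) := by
    -- Contractivity makes the modulus of continuity independent of n; on a compact space, pointwise
    -- convergence of an equicontinuous family is uniform.
    have heq : Equicontinuous fun n y => L n (F₀ y) := by
      intro y₀
      rw [Metric.equicontinuousAt_iff_right]
      intro δ hδ
      filter_upwards [Metric.tendsto_nhds.1 (F₀.continuous.tendsto y₀) δ hδ] with y hy n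
      rw [dist_comm]
      exact (hle n _ _).trans_lt hy
    rw [ContinuousMap.tendsto_iff_tendstoUniformly]
    have h2 := (heq.tendsto_uniformFun_iff_pi atTop fun y => L₀ (F₀ y)).2
      (tendsto_pi_nhds.2 fun y => hlim (F₀ y))
    exact UniformFun.tendsto_iff_tendstoUniformly.1 h2
  refine h1.congr_dist ?_
  refine squeeze_zero (fun _ => dist_nonneg) (fun n => ?_) (tendsto_iff_dist_tendsto_zero.1 hF)
  rw [dist_comm, ContinuousMap.dist_le dist_nonneg]
  intro y
  exact (hle n _ _).trans (ContinuousMap.dist_apply_le_dist y)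

lemma tendsto_kernelComp [T2Space X] {L : ℕ → C(X, ℝ) →L[ℝ] ℝ} {L₀ : C(X, ℝ) →L[ℝ] ℝ} (hL : ∀ n, ‖L n‖ ≤ 1)
    (hlim : ∀ f, Tendsto (fun n => L n f) atTop (𝓝 (L₀ f))) {G K : ℕ → C(X × X, ℝ)}
    {G₀ K₀ : C(X × X, ℝ)} (hG : Tendsto G atTop (𝓝 G₀)) (hK : Tendsto K atTop (𝓝 K₀)) :
    Tendsto (fun n => kernelComp (L n) (G n) (K n)) atTop (𝓝 (kernelComp L₀ G₀ K₀)) :=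
  tendsto_comp_of_tendsto_pointwise hL hlim
    ((continuous_kernelPairing.tendsto (G₀, K₀)).comp (hG.prodMk_nhds hK))

lemma tendsto_apply_of_tendsto_pointwise {L : ℕ → C(X, ℝ) →L[ℝ] ℝ} {L₀ : C(X, ℝ) →L[ℝ] ℝ}
    (hL : ∀ n, ‖L n‖ ≤ 1) (hlim : ∀ f, Tendsto (fun n => L n f) atTop (𝓝 (L₀ f)))
    {f : ℕ → C(X, ℝ)} {f₀ : C(X, ℝ)} (hf : Tendsto f atTop (𝓝 f₀)) :
    Tendsto (fun n => L n (f n)) atTop (𝓝 (L₀ f₀)) := by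
  refine (hlim f₀).congr_dist ?_
  refine squeeze_zero (fun _ => dist_nonneg) (fun n => ?_) (tendsto_iff_dist_tendsto_zero.1 hf)
  rw [dist_comm, dist_eq_norm, dist_eq_norm, ← map_sub]
  exact (L n).le_of_opNorm_le (hL n) _ |>.trans (one_mul _).le

/-- A δ/3 argument from contractivity; it reduces almost sure convergence for all f to countably
many f. -/
lemma tendsto_pointwise_of_denseRange {L : ℕ → C(X, ℝ) →L[ℝ] ℝ} {L₀ : C(X, ℝ) →L[ℝ] ℝ}
    (hL : ∀ n, ‖L n‖ ≤ 1) (hL₀ : ‖L₀‖ ≤ 1) {κ : Type*} {d : κ → C(X, ℝ)} (hd : DenseRange d)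
    (hlim : ∀ k, Tendsto (fun n => L n (d k)) atTop (𝓝 (L₀ (d k)))) (f : C(X, ℝ)) :
    Tendsto (fun n => L n f) atTop (𝓝 (L₀ f)) := by
  rw [Metric.tendsto_nhds]
  intro δ hδ
  obtain ⟨k, hk⟩ := Metric.denseRange_iff.1 hd f (δ / 3) (by positivity)
  have hle : ∀ M : C(X, ℝ) →L[ℝ] ℝ, ‖M‖ ≤ 1 → dist (M f) (M (d k)) ≤ dist f (d k) := fun M hM => by
    rw [dist_eq_norm, dist_eq_norm, ← map_sub]
    exact (M.le_of_opNorm_le hM _).trans (one_mul _).le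
  filter_upwards [Metric.tendsto_nhds.1 (hlim k) (δ / 3) (by positivity)] with n hn
  have h1 := dist_triangle4 (L n f) (L n (d k)) (L₀ (d k)) (L₀ f)
  have h2 := hle (L n) (hL n)
  have h3 := hle L₀ hL₀
  rw [dist_comm (L₀ f)] at h3
  linarith

/-- The kernel of `(K₁ K₀)ᵏ K₁`, where products are taken along the functional `L`. -/
def kernelIter (L : C(X, ℝ) →L[ℝ] ℝ) (K₀ K₁ : C(X × X, ℝ)) : ℕ → C(X × X, ℝ)
  | 0 => K₁
  | k + 1 => kernelComp L (kernelComp L (kernelIter L K₀ K₁ k) K₀) K₁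

/-- The trace of `(K₀ K₁)ᵏ⁺¹`, where products and the trace are taken along the functional `L`. -/
def kernelMoment (L : C(X, ℝ) →L[ℝ] ℝ) (K₀ K₁ : C(X × X, ℝ)) (k : ℕ) : ℝ :=
  L (kernelDiag (kernelComp L K₀ (kernelIter L K₀ K₁ k)))

lemma tendsto_kernelMoment [T2Space X] {L : ℕ → C(X, ℝ) →L[ℝ] ℝ} {L₀ : C(X, ℝ) →L[ℝ] ℝ} (hL : ∀ n, ‖L n‖ ≤ 1)
    (hlim : ∀ f, Tendsto (fun n => L n f) atTop (𝓝 (L₀ f))) (K₀ K₁ : C(X × X, ℝ)) (k : ℕ) :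
    Tendsto (fun n => kernelMoment (L n) K₀ K₁ k) atTop (𝓝 (kernelMoment L₀ K₀ K₁ k)) := by
  have hiter : Tendsto (fun n => kernelIter (L n) K₀ K₁ k) atTop (𝓝 (kernelIter L₀ K₀ K₁ k)) := by
    induction k with
    | zero => exact tendsto_const_nhds
    | succ k ih =>
      exact tendsto_kernelComp hL hlim (tendsto_kernelComp hL hlim ih tendsto_const_nhds)
        tendsto_const_nhds
  exact tendsto_apply_of_tendsto_pointwise hL hlim ((continuous_kernelDiag.tendsto _).comp
    (tendsto_kernelComp hL hlim tendsto_const_nhds hiter))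

end KernelComposition

/-! ### Sample averages, integration against ρ, and the strong law -/

section Averages

variable {X : Type*} [TopologicalSpace X]

/-- The average over `n` sample points, as a functional on continuous functions. -/
noncomputable def empiricalFunctional {n : ℕ} (x : Fin n → X) : C(X, ℝ) →L[ℝ] ℝ :=
  (1 / (n : ℝ)) • ∑ i, ContinuousMap.evalCLM ℝ (x i)

lemma empiricalFunctional_apply {n : ℕ} (x : Fin n → X) (f : C(X, ℝ)) :
    empiricalFunctional x f = 1 / (n : ℝ) * ∑ i, f (x i) := by
  simp [empiricalFunctional]

lemma trace_gramMatrix {n : ℕ} (x : Fin n → X) (K : C(X × X, ℝ)) :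
    (gramMatrix K x).trace = empiricalFunctional x (kernelDiag K) := by
  rw [empiricalFunctional_apply, Finset.mul_sum]
  rfl

variable [CompactSpace X]

lemma norm_empiricalFunctional_le {n : ℕ} (x : Fin n → X) : ‖empiricalFunctional x‖ ≤ 1 := by
  refine ContinuousLinearMap.opNorm_le_bound _ zero_le_one fun f => ?_
  rw [empiricalFunctional_apply, norm_mul, one_mul, Real.norm_of_nonneg (by positivity)]
  rcases Nat.eq_zero_or_pos n with rfl | hn
  · simp
  · have h : ‖∑ i, f (x i)‖ ≤ n * ‖f‖ := by
      refine (norm_sum_le_of_le _ fun i _ => f.norm_coe_le_norm (x i)).trans ?_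
      simp
    rw [one_div, inv_mul_le_iff₀ (by positivity)]
    exact h

/-- Of the two factors 1/n, one averages over the intermediate sample point and the other normalizes
the resulting Gram matrix. -/
lemma gramMatrix_mul {n : ℕ} (x : Fin n → X) (G K : C(X × X, ℝ)) :
    gramMatrix G x * gramMatrix K x = gramMatrix (kernelComp (empiricalFunctional x) G K) x := by
  ext i j
  have h : kernelComp (empiricalFunctional x) G K (x i, x j)
      = empiricalFunctional x (kernelPairing G K (x i, x j)) := rfl
  simp only [Matrix.mul_apply, gramMatrix, Matrix.of_apply, h, empiricalFunctional_apply,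
    kernelPairing, ContinuousMap.curry_apply, ContinuousMap.coe_mk, Finset.mul_sum]
  refine Finset.sum_congr rfl fun k _ => ?_
  ring

lemma trace_gramMatrix_mul_pow {n : ℕ} (x : Fin n → X) (K₀ K₁ : C(X × X, ℝ)) (k : ℕ) :
    ((gramMatrix K₀ x * gramMatrix K₁ x) ^ (k + 1)).trace
      = kernelMoment (empiricalFunctional x) K₀ K₁ k := by
  have h : ∀ k, (gramMatrix K₀ x * gramMatrix K₁ x) ^ (k + 1)
      = gramMatrix K₀ x * gramMatrix (kernelIter (empiricalFunctional x) K₀ K₁ k) x := by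
    intro k
    induction k with
    | zero => rw [zero_add, pow_one]; rfl
    | succ k ih =>
      rw [pow_succ, ih, kernelIter, ← gramMatrix_mul, ← gramMatrix_mul]
      simp only [mul_assoc]
  rw [h, gramMatrix_mul, trace_gramMatrix]
  rfl

variable [MeasurableSpace X] [BorelSpace X] (ρ : Measure X) [IsProbabilityMeasure ρ]

/-- Integration against `ρ`, as a functional on continuous functions. -/
noncomputable def integralFunctional : C(X, ℝ) →L[ℝ] ℝ :=
  LinearMap.mkContinuous
    { toFun := fun f => ∫ x, f x ∂ρ
      map_add' := fun f g => integral_add (integrable_of_continuous ρ f.continuous)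
        (integrable_of_continuous ρ g.continuous)
      map_smul' := fun c f => integral_const_mul c f } 1 fun f => by
    rw [one_mul]
    refine (norm_integral_le_of_norm_le_const
      (Eventually.of_forall fun x => f.norm_coe_le_norm x)).trans ?_
    simp

lemma integralFunctional_apply (f : C(X, ℝ)) : integralFunctional ρ f = ∫ x, f x ∂ρ := rfl

lemma norm_integralFunctional_le : ‖integralFunctional ρ‖ ≤ 1 :=
  LinearMap.mkContinuous_norm_le _ zero_le_one _

variable [SecondCountableTopology X]

/-- Fubini. It is the counterpart of `gramMatrix_mul`, with the same `kernelComp` along another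
functional. -/
lemma covarianceOperator_mul (G K : C(X × X, ℝ)) :
    covarianceOperator ρ G * covarianceOperator ρ K
      = covarianceOperator ρ (kernelComp (integralFunctional ρ) G K) := by
  ext φ : 1
  apply Lp.ext
  filter_upwards [covarianceOperator_apply_ae ρ G (covarianceOperator ρ K φ),
    covarianceOperator_apply_ae ρ (kernelComp (integralFunctional ρ) G K) φ] with x h1 h2
  rw [h2]
  refine h1.trans ?_
  have h3 : ∫ s, G (x, s) * covarianceOperator ρ K φ s ∂ρ
      = ∫ s, ∫ t, G (x, s) * (K (s, t) * φ t) ∂ρ ∂ρ := by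
    refine integral_congr_ae ?_
    filter_upwards [covarianceOperator_apply_ae ρ K φ] with s hs
    rw [hs, integral_const_mul]
  rw [h3, integral_integral_swap]
  · refine integral_congr_ae (Eventually.of_forall fun t => ?_)
    have h4 : kernelComp (integralFunctional ρ) G K (x, t) = ∫ s, G (x, s) * K (s, t) ∂ρ := rfl
    simp only
    rw [h4, ← integral_mul_const]
    simp only [mul_assoc]
  · refine (integrable_kernel_mul ρ K (integrable_of_continuous ρ
      (by fun_prop : Continuous fun s => G (x, s))) (integrable_coe_Lp ρ φ)).congr
      (Eventually.of_forall fun p => ?_)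
    simp only [Function.uncurry]
    ring

/-- The trace of G K₀ is ∫∫ K₀(x,s) G(s,x), the diagonal of K₀ composed with G; hence the order K₁K₀
here against K₀K₁ in `kernelMoment`. -/
lemma hasSum_inner_covarianceOperator_mul_pow {κ : Type*} (e : HilbertBasis κ ℝ (Lp ℝ 2 ρ))
    (K₀ K₁ : C(X × X, ℝ)) (k : ℕ) :
    HasSum (fun j => ⟪((covarianceOperator ρ K₁ * covarianceOperator ρ K₀) ^ (k + 1)) (e j),
      e j⟫_ℝ) (kernelMoment (integralFunctional ρ) K₀ K₁ k) := by
  have h : ∀ k, (covarianceOperator ρ K₁ * covarianceOperator ρ K₀) ^ (k + 1)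
      = covarianceOperator ρ (kernelIter (integralFunctional ρ) K₀ K₁ k)
        * covarianceOperator ρ K₀ := by
    intro k
    induction k with
    | zero => rw [zero_add, pow_one]; rfl
    | succ k ih =>
      rw [pow_succ, ih, kernelIter, ← covarianceOperator_mul, ← covarianceOperator_mul]
      simp only [mul_assoc]
  simp_rw [h]
  exact hasSum_inner_covarianceOperator_mul ρ e _ K₀

/-- Almost surely, the empirical measures of an i.i.d. sequence converge weakly. -/
lemma ae_tendsto_empiricalFunctional [T2Space X] {Ω : Type*}
    [MeasurableSpace Ω] (P : Measure Ω)
    [IsProbabilityMeasure P] (x : ℕ → Ω → X) (hlaw : ∀ i, HasLaw (x i) ρ P)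
    (hindep : iIndepFun x P) :
    ∀ᵐ ω ∂P, ∀ f : C(X, ℝ), Tendsto (fun n : ℕ => empiricalFunctional (fun i : Fin n => x i ω) f)
      atTop (𝓝 (integralFunctional ρ f)) := by
  have hf : ∀ f : C(X, ℝ), ∀ᵐ ω ∂P,
      Tendsto (fun n : ℕ => empiricalFunctional (fun i : Fin n => x i ω) f)
        atTop (𝓝 (integralFunctional ρ f)) := by
    intro f
    have hint : Integrable (fun ω => f (x 0 ω)) P := by
      have := integrable_of_continuous ρ f.continuous
      rw [← (hlaw 0).map_eq] at this
      exact this.comp_aemeasurable (hlaw 0).aemeasurable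
    have h := strong_law_ae_real (μ := P) (fun i ω => f (x i ω)) hint
      (fun i j hij => (hindep.indepFun hij).comp f.measurable f.measurable)
      (fun i => ((hlaw i).identDistrib (hlaw 0)).comp f.measurable)
    have hE : P[fun ω => f (x 0 ω)] = integralFunctional ρ f := by
      rw [integralFunctional_apply, ← (hlaw 0).map_eq, integral_map (hlaw 0).aemeasurable
        f.continuous.aestronglyMeasurable]
    filter_upwards [h] with ω hω
    rw [hE] at hω
    refine hω.congr fun n => ?_
    rw [empiricalFunctional_apply, Finset.sum_range, one_div, div_eq_inv_mul]
  have hD := ae_all_iff.2 fun k => hf (TopologicalSpace.denseSeq C(X, ℝ) k)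
  filter_upwards [hD] with ω hω
  exact tendsto_pointwise_of_denseRange (fun n => norm_empiricalFunctional_le _)
    (norm_integralFunctional_le ρ) (TopologicalSpace.denseRange_denseSeq _) hω

end Averages

end GPSinkhorn

/-! ### Convergence from moments and the main theorem -/

namespace GPSinkhorn

open Polynomial in
/-- Convergence of the power sums of uniformly summable nonnegative numbers implies convergence of
the sums of `G`, for `G` continuous, differentiable at `0`, with `G 0 = 0`. -/
lemma tendsto_sum_of_tendsto_moments {ι : Type*} {lam : ι → ℝ} (hlam : ∀ i, 0 ≤ lam i)
    {μ : (n : ℕ) → Fin n → ℝ} (hμ : ∀ n i, 0 ≤ μ n i) {m : ℕ → ℝ}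
    (hm : ∀ k, HasSum (fun i => lam i ^ (k + 1)) (m k))
    (hlim : ∀ k, Tendsto (fun n => ∑ i, μ n i ^ (k + 1)) atTop (𝓝 (m k)))
    {G : ℝ → ℝ} (hG : Continuous G) (hG' : DifferentiableAt ℝ G 0) (hG0 : G 0 = 0) :
    Tendsto (fun n => ∑ i, G (μ n i)) atTop (𝓝 (∑' i, G (lam i))) := by
  have hm0 : HasSum lam (m 0) := by simpa using hm 0
  -- One R bounds the total mass of every row and of the limit, hence every single number too.
  obtain ⟨R, hR⟩ := (hlim 0).bddAbove_range
  have hμR : ∀ n, ∑ i, μ n i ≤ R := fun n => by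
    have h := hR ⟨n, rfl⟩
    simpa using h
  have hmR : m 0 ≤ R := le_of_tendsto (hlim 0) (Eventually.of_forall fun n => hR ⟨n, rfl⟩)
  have hR0 : 0 ≤ R := (hm0.nonneg hlam).trans hmR
  have hμI : ∀ n i, μ n i ∈ Set.Icc 0 R := fun n i =>
    ⟨hμ n i, (Finset.single_le_sum (fun j _ => hμ n j) (Finset.mem_univ i)).trans (hμR n)⟩
  have hlamI : ∀ i, lam i ∈ Set.Icc 0 R := fun i =>
    ⟨hlam i, (le_hasSum hm0 i fun j _ => hlam j).trans hmR⟩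
  have hdslope : ∀ t, G t = t * dslope G 0 t := fun t => by
    have h := sub_smul_dslope G 0 t
    rw [hG0, sub_zero, sub_zero, smul_eq_mul] at h
    exact h.symm
  have hcont : ContinuousOn (dslope G 0) (Set.Icc 0 R) :=
    ((continuousOn_dslope univ_mem).2 ⟨hG.continuousOn, hG'⟩).mono (Set.subset_univ _)
  rw [Metric.tendsto_nhds]
  intro δ hδ
  -- Chosen so that ηR ≤ δ/3; the +1 covers R = 0. Weierstrass is applied to G(t)/t, not to G, so
  -- that the error ηt sums to at most ηR however many terms there are.
  set η : ℝ := δ / (3 * (R + 1)) with hη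
  have hη0 : 0 < η := by positivity
  have hηR : η * R ≤ δ / 3 := by
    rw [hη, div_mul_eq_mul_div, div_le_div_iff₀ (by positivity) (by norm_num)]
    nlinarith
  obtain ⟨p, hp⟩ := exists_polynomial_near_of_continuousOn 0 R _ hcont η hη0
  have hbd : ∀ t ∈ Set.Icc 0 R, |G t - t * p.eval t| ≤ η * t := by
    intro t ht
    rw [hdslope, ← mul_sub, abs_mul, abs_of_nonneg ht.1, mul_comm, abs_sub_comm]
    exact mul_le_mul_of_nonneg_right (hp t ht).le ht.1
  have hexp : ∀ t : ℝ, t * p.eval t = ∑ k ∈ Finset.range (p.natDegree + 1), p.coeff k * t ^ (k + 1) := by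
    intro t
    rw [eval_eq_sum_range, Finset.mul_sum]
    exact Finset.sum_congr rfl fun k _ => by ring
  have hpl : HasSum (fun i => lam i * p.eval (lam i))
      (∑ k ∈ Finset.range (p.natDegree + 1), p.coeff k * m k) := by
    simp only [hexp]
    exact hasSum_sum fun k _ => (hm k).mul_left _
  have hplim : Tendsto (fun n => ∑ i, μ n i * p.eval (μ n i)) atTop
      (𝓝 (∑ k ∈ Finset.range (p.natDegree + 1), p.coeff k * m k)) := by
    have h : ∀ n, ∑ i, μ n i * p.eval (μ n i)
        = ∑ k ∈ Finset.range (p.natDegree + 1), p.coeff k * ∑ i, μ n i ^ (k + 1) := by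
      intro n
      simp only [hexp, Finset.mul_sum]
      exact Finset.sum_comm
    simp only [h]
    exact tendsto_finsetSum _ fun k _ => (hlim k).const_mul _
  have hdiff : Summable fun i => G (lam i) - lam i * p.eval (lam i) :=
    Summable.of_norm_bounded (hm0.summable.mul_left η) fun i => hbd _ (hlamI i)
  have hGs : Summable fun i => G (lam i) := by
    simpa using hdiff.add hpl.summable
  have h1 : dist (∑' i, G (lam i)) (∑ k ∈ Finset.range (p.natDegree + 1), p.coeff k * m k)
      ≤ δ / 3 := by
    rw [← hpl.tsum_eq, dist_eq_norm, ← hGs.tsum_sub hpl.summable]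
    refine (tsum_of_norm_bounded (hm0.mul_left η) fun i => hbd _ (hlamI i)).trans ?_
    exact (mul_le_mul_of_nonneg_left hmR hη0.le).trans hηR
  have h2 : ∀ n, dist (∑ i, G (μ n i)) (∑ i, μ n i * p.eval (μ n i)) ≤ δ / 3 := by
    intro n
    rw [dist_eq_norm, ← Finset.sum_sub_distrib]
    refine (norm_sum_le_of_le _ fun i _ => hbd _ (hμI n i)).trans ?_
    rw [← Finset.mul_sum]
    exact (mul_le_mul_of_nonneg_left (hμR n) hη0.le).trans hηR
  filter_upwards [Metric.tendsto_nhds.1 hplim (δ / 3) (by positivity)] with n hn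
  have h3 := dist_triangle4 (∑ i, G (μ n i)) (∑ i, μ n i * p.eval (μ n i))
    (∑ k ∈ Finset.range (p.natDegree + 1), p.coeff k * m k) (∑' i, G (lam i))
  rw [dist_comm] at h1
  linarith [h2 n]

lemma half_add_sqrt_pos (t : ℝ) : 0 < 1 / 2 + 1 / 2 * √t := by positivity

lemma continuous_scalarF : Continuous scalarF := by
  unfold scalarF
  refine ((by fun_prop : Continuous fun t : ℝ => √(1 + t) - 1)).sub ?_
  exact (by fun_prop : Continuous fun t : ℝ => 1 / 2 + 1 / 2 * √(1 + t)).log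
    fun t => (half_add_sqrt_pos _).ne'

lemma differentiableAt_scalarF : DifferentiableAt ℝ scalarF 0 := by
  unfold scalarF
  have h : DifferentiableAt ℝ (fun t : ℝ => √(1 + t)) 0 :=
    ((differentiableAt_const 1).add differentiableAt_id).sqrt (by simp)
  exact (h.sub_const 1).sub (((h.const_mul _).const_add _).log (half_add_sqrt_pos _).ne')

lemma scalarF_zero : scalarF 0 = 0 := by
  norm_num [scalarF]

/-! ### Consistency along a fixed sample sequence -/

section Convergence

variable {X : Type*} [TopologicalSpace X]

lemma posSemidef_gramMatrix {K : C(X × X, ℝ)} (hK : IsCovarianceKernel K) {n : ℕ} (x : Fin n → X) :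
    (gramMatrix K x).PosSemidef :=
  (hK n x).smul (α := ℝ) (by positivity : 0 ≤ 1 / (n : ℝ))

variable [CompactSpace X] [T2Space X] [SecondCountableTopology X] [MeasurableSpace X] [BorelSpace X]
  (ρ : Measure X) [IsProbabilityMeasure ρ]

/-- Consistency of the estimator of the entropic Wasserstein distance along every sequence whose
empirical measures converge weakly to `ρ`. -/
theorem tendsto_empEntropicW2Sq {K₀ K₁ : C(X × X, ℝ)} (hK₀ : IsCovarianceKernel K₀)
    (hK₁ : IsCovarianceKernel K₁) (ε : ℝ) {x : ℕ → X}
    (hx : ∀ f : C(X, ℝ), Tendsto (fun n : ℕ => empiricalFunctional (fun i : Fin n => x i) f)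
      atTop (𝓝 (integralFunctional ρ f))) :
    Tendsto (fun n : ℕ => empEntropicW2Sq ε K₀ K₁ (fun i : Fin n => x i)) atTop
      (𝓝 (entropicW2Sq ρ ε K₀ K₁)) := by
  obtain ⟨w, e, -⟩ := exists_hilbertBasis ℝ (Lp ℝ 2 ρ)
  have htrace : ∀ {K : C(X × X, ℝ)}, IsCovarianceKernel K →
      opTrace (covarianceOperator ρ K) = integralFunctional ρ (kernelDiag K) := fun hK =>
    (hasSum_inner_covarianceOperator hK _).tsum_eq
  obtain ⟨ι, lam, hlam, hW, hmom⟩ := exists_opEntropicW2Sq_eq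
    (isPositive_covarianceOperator (ρ := ρ) hK₀) (isPositive_covarianceOperator (ρ := ρ) hK₁)
    (isCompactOperator_covarianceOperator ρ K₀) (isCompactOperator_covarianceOperator ρ K₁) e
    (hasSum_inner_covarianceOperator hK₀ e).summable
  have hmom' : ∀ k, HasSum (fun i => lam i ^ (k + 1))
      (kernelMoment (integralFunctional ρ) K₀ K₁ k) := by
    intro k
    obtain ⟨a, ha, ha'⟩ := hmom k
    rwa [ha'.unique (hasSum_inner_covarianceOperator_mul_pow ρ e K₀ K₁ k)] at ha
  choose μ hμ hF hμmom using fun n : ℕ => exists_matF_eq_sum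
    (posSemidef_gramMatrix hK₀ fun i : Fin n => x i)
    (posSemidef_gramMatrix hK₁ fun i : Fin n => x i)
  have hc : 0 ≤ 16 / ε ^ 2 := by positivity
  have hsum : Tendsto (fun n => ∑ i, scalarF (16 / ε ^ 2 * μ n i)) atTop
      (𝓝 (∑' i, scalarF (16 / ε ^ 2 * lam i))) := by
    -- The factor 16/ε² goes into G, so the moments are those of the unscaled products.
    refine tendsto_sum_of_tendsto_moments hlam hμ hmom' (fun k => ?_)
      (G := fun t => scalarF (16 / ε ^ 2 * t))
      (continuous_scalarF.comp (continuous_const_mul _)) ?_ (by simp [scalarF_zero])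
    · simp only [hμmom, trace_gramMatrix_mul_pow]
      exact tendsto_kernelMoment (fun n => norm_empiricalFunctional_le _) hx K₀ K₁ k
    · refine DifferentiableAt.comp (g := scalarF) 0 ?_ (differentiableAt_id.const_mul _)
      simpa using differentiableAt_scalarF
  rw [entropicW2Sq, hW, htrace hK₀, htrace hK₁]
  simp only [empEntropicW2Sq, Matrix.trace_add, trace_gramMatrix, hF _ _ hc]
  exact ((hx _).add (hx _)).sub (hsum.const_mul _)

/-- Consistency of the estimator of the Sinkhorn divergence along every sequence whose empirical
measures converge weakly to `ρ`. -/
theorem tendsto_empSinkhornDiv {K₀ K₁ : C(X × X, ℝ)} (hK₀ : IsCovarianceKernel K₀)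
    (hK₁ : IsCovarianceKernel K₁) (ε : ℝ) {x : ℕ → X}
    (hx : ∀ f : C(X, ℝ), Tendsto (fun n : ℕ => empiricalFunctional (fun i : Fin n => x i) f)
      atTop (𝓝 (integralFunctional ρ f))) :
    Tendsto (fun n : ℕ => empSinkhornDiv ε K₀ K₁ (fun i : Fin n => x i)) atTop
      (𝓝 (sinkhornDiv ρ ε K₀ K₁)) := by
  simp only [empSinkhornDiv, sinkhornDiv]
  exact (tendsto_empEntropicW2Sq ρ hK₀ hK₁ ε hx).sub
    (((tendsto_empEntropicW2Sq ρ hK₀ hK₀ ε hx).add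
      (tendsto_empEntropicW2Sq ρ hK₁ hK₁ ε hx)).const_mul _)

end Convergence

end GPSinkhorn

theorem mainTheorem3 {d : ℕ} (𝒳 : Set (EuclideanSpace ℝ (Fin d))) [CompactSpace 𝒳]
    (ρ : Measure 𝒳) [IsProbabilityMeasure ρ]
    (K₀ K₁ : C(𝒳 × 𝒳, ℝ))
    (hK₀ : GPSinkhorn.IsCovarianceKernel K₀) (hK₁ : GPSinkhorn.IsCovarianceKernel K₁)
    (ε : ℝ) (hε : 0 < ε)
    {Ω : Type*} [MeasurableSpace Ω] (P : Measure Ω) [IsProbabilityMeasure P]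
    (x : ℕ → Ω → 𝒳) (hlaw : ∀ i, HasLaw (x i) ρ P) (hindep : iIndepFun x P) :
    ∀ᵐ ω ∂P,
      Tendsto (fun n : ℕ => GPSinkhorn.empEntropicW2Sq ε K₀ K₁ (fun i : Fin n => x i ω))
          atTop (𝓝 (GPSinkhorn.entropicW2Sq ρ ε K₀ K₁)) ∧
        Tendsto (fun n : ℕ => GPSinkhorn.empSinkhornDiv ε K₀ K₁ (fun i : Fin n => x i ω))
          atTop (𝓝 (GPSinkhorn.sinkhornDiv ρ ε K₀ K₁)) := by
  -- This event does not depend on the kernels, so one ω serves both limits and all three terms of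
  -- the divergence.
  filter_upwards [GPSinkhorn.ae_tendsto_empiricalFunctional ρ P x hlaw hindep] with ω hω
  exact ⟨GPSinkhorn.tendsto_empEntropicW2Sq ρ hK₀ hK₁ ε (x := fun i => x i ω) hω,
    GPSinkhorn.tendsto_empSinkhornDiv ρ hK₀ hK₁ ε (x := fun i => x i ω) hω⟩
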